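/- Let $\mathbb F$ be a finite field of odd cardinality $q$, let $\mathbb E/\mathbb F$ be a field extension of degree $1$ or $2$, and let $x\mapsto x^c$ be the generator of $\mathrm{Gal}(\mathbb E/\mathbb F)$. Let $C$ be an algebraically closed field whose characteristic does not divide $q$, with a fixed square root $\sqrt q\in C$; put $\sqrt{q^j}=\sqrt q^{\,j}$. Let $V$ be a finite dimensional $\mathbb E$-vector space with an $\epsilon$-sesquilinear form $\langle\cdot,\cdot\rangle$ ($\epsilon=\pm1$): additive in both variables, $\mathbb E$-linear in the first one, and $\langle y,x\rangle=\epsilon\langle x,y\rangle^c$. Assume that the form is nondegenerate or identically zero. Let $G(V)\subset \mathrm{GL}_{\mathbb E}(V)$ be its isometry group, and let $\mathfrak g(V)=\{A\in\mathrm{End}_{\mathbb E}(V):\langle Ax,y\rangle+\langle x,Ay\rangle=0 \text{ for all } x,y\}$ be its Lie algebra. Let $G^0(V)$ be the group of rational points of the identity component: it is the special orthogonal group if $\mathbb E=\mathbb F$, $\epsilon=1$ and the form is nondegenerate, and $G^0(V)=G(V)$ otherwise (symplectic, unitary and general linear cases). For a character $\chi\colon\mathbb E^\times\to C^\times$ and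 a representation $\pi$ of $G(V)$ over $C$, set $$\mathcal J(\pi,\chi)=\frac1{\sqrt{|\mathfrak g(V)|}}\sum_{\substack{g\in G^0(V)\\ \det(1+g)\neq0}}\chi(\det(1+g))\,\pi(g)\in\mathrm{End}_{G(V)}(\pi).$$ If $\pi$ is irreducible, $\mathcal J(\pi,\chi)$ is a scalar operator, and we write $\mathcal J(\pi,\chi)=J(\pi,\chi)\cdot\mathrm{id}_\pi$. A general linear group is regarded as the isometry group of the zero form. Put $\chi^{1+c}(x)=\chi(x\cdot x^c)$ and $\chi^{-c}(x)=\chi(x^c)^{-1}$, and for a representation $\tau$ of $\mathrm{GL}_{\mathbb E}(X)$ let $\tau\otimes\chi^{-c}$ denote $a\mapsto\chi^{-c}(\det a)\,\tau(a)$. If the form is nondegenerate, let $V=X\oplus V_0\oplus Y$, where $X$ and $Y$ are totally isotropic subspaces in duality with respect to the form and $V_0$ is nondegenerate and orthogonal to $X$ and $Y$. If the form is zero, let $V=X\oplus V_0$. Let $P\subset G(V)$ be the parabolic subgroup stabilizing the flag $0\subset X\subset X\oplus V_0\subset V$; its Levi part is $\mathrm{GL}_{\mathbb E}(X)\times G(V_0)$.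 Let $\tau$ and $\pi_0$ be irreducible representations over $C$ of $\mathrm{GL}_{\mathbb E}(X)$ and $G(V_0)$, respectively, let $\rho=\mathrm{Ind}_P^{G(V)}(\tau\boxtimes\pi_0)$ be the parabolically induced representation, and let $\pi\subset\rho$ be an irreducible subrepresentation. Suppose that $\chi^{1+c}\neq1$. Then: 1. If the form is nondegenerate, $J(\pi,\chi)=J(\tau\otimes\chi^{-c},\chi^{1+c})\,J(\pi_0,\chi)$. 2. If the form is identically zero, $J(\pi,\chi)=J(\tau,\chi)\,J(\pi_0,\chi)$. Moreover, in both cases the operator $\mathcal J(\rho,\chi)$ on the full induced representation $\rho$ is scalar, namely multiplication by the product on the right hand side. -/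

import Mathlib

open scoped TensorProduct

noncomputable section

namespace DoublingJacobi

variable {F : Type*} {E : Type*} [Field F] [Field E] [Algebra F E]

/-- An `ε`-sesquilinear form on the `E`-vector space `V`, with respect to the involution `c` of
`E/F` and the sign `ε ∈ {1, -1}`: linear in the first variable, `c`-semilinear in the second one,
and satisfying `⟨y, x⟩ = ε · c ⟨x, y⟩`. -/
structure EpsForm (c : E ≃ₐ[F] E) (ε : ℤˣ) (V : Type*) [AddCommGroup V] [Module E V] where
  form : V →ₗ[E] V →ₛₗ[(c : E →+* E)] E
  symm : ∀ x y : V, form y x = ((ε : ℤ) : E) * c (form x y)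

namespace EpsForm

variable {c : E ≃ₐ[F] E} {ε : ℤˣ} {V : Type*} [AddCommGroup V] [Module E V]

/-- The form which is identically zero. -/
instance : Zero (EpsForm c ε V) := ⟨{ form := 0, symm := by intro x y; simp }⟩

def IsNondegenerate (B : EpsForm c ε V) : Prop :=
  ∀ x : V, x ≠ 0 → ∃ y : V, B.form x y ≠ 0

/-- The restriction of the form to a subspace. -/
def restrict (B : EpsForm c ε V) (W : Submodule E V) : EpsForm c ε W where
  form := B.form.domRestrict₁₂ W W
  symm x y := B.symm x y

/-- The isometry group `G(V)`, as a subgroup of `GL_E(V)`. -/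
def isometryGroup (B : EpsForm c ε V) : Subgroup (V ≃ₗ[E] V) where
  carrier := {g | ∀ x y : V, B.form (g x) (g y) = B.form x y}
  one_mem' := by intro x y; rfl
  mul_mem' := by
    intro g h hg hh x y
    exact (hg (h x) (h y)).trans (hh x y)
  inv_mem' := by
    intro g hg x y
    have h := hg (g⁻¹ x) (g⁻¹ y)
    have e : ∀ z, g (g⁻¹ z) = z := fun z => g.apply_symm_apply z
    rw [e, e] at h
    exact h.symm

/-- The form is orthogonal: `E = F`, `ε = 1` and the form is nondegenerate. -/
def IsOrthogonal (B : EpsForm c ε V) : Prop :=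
  Module.finrank F E = 1 ∧ ε = 1 ∧ B.IsNondegenerate

/-- The elements of (the group of rational points of) the identity component `G⁰(V)` of `G(V)`, for
a form which is nondegenerate or identically zero: the special orthogonal group for an orthogonal
form, and the whole of `G(V)` in the symplectic, unitary and general linear cases, where the
isometry group is connected. -/
def identityComponent (B : EpsForm c ε V) : Set B.isometryGroup :=
  {g | B.IsOrthogonal → LinearEquiv.det (g : V ≃ₗ[E] V) = 1}

/-- The Lie algebra of `G(V)`, as an `F`-vector space. -/
def lieAlgebra [Module F V] [IsScalarTower F E V] (B : EpsForm c ε V) :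
    Submodule F (V →ₗ[E] V) where
  carrier := {A | ∀ x y : V, B.form (A x) y + B.form x (A y) = 0}
  zero_mem' := by intro x y; simp
  add_mem' := by
    intro A A' hA hA' x y
    have h := hA x y
    have h' := hA' x y
    simp only [LinearMap.add_apply, map_add]
    linear_combination h + h'
  smul_mem' := by
    intro a A hA x y
    have h := hA x y
    have e : ∀ z : V, (a • A) z = algebraMap F E a • A z := fun z => by
      rw [LinearMap.smul_apply, algebraMap_smul]
    rw [e, e, map_smul, LinearMap.smul_apply, LinearMap.map_smulₛₗ]
    simp only [smul_eq_mul, RingHom.coe_coe, AlgEquiv.commutes]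
    linear_combination (algebraMap F E a) * h

end EpsForm

section Jacobi

variable {c : E ≃ₐ[F] E} {ε : ℤˣ} {V : Type*} [AddCommGroup V] [Module E V]
variable {C : Type*} [Field C] {W : Type*} [AddCommMonoid W] [Module C W]

open Classical in
/-- The class function `g ↦ χ(det(1 + g))` on `G(V)`, extended by zero to the elements `g` which do
not lie in `G⁰(V)` or for which `det(1 + g) = 0`. -/
def jacobiKernel (χ : Eˣ →* Cˣ) (B : EpsForm c ε V) (g : B.isometryGroup) : C :=
  if h : g ∈ B.identityComponent ∧
      LinearMap.det (1 + ((g : V ≃ₗ[E] V) : V →ₗ[E] V)) ≠ 0 then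
    (χ (Units.mk0 _ h.2) : C)
  else 0

/-- The non-abelian Jacobi sum
`𝒥(π, χ) = |𝔤|^{-1/2} ∑_{g ∈ G(V)} jacobiKernel χ g • π(g)` of a representation `π` of `G(V)`, where
`𝔤` is the Lie algebra of `G(V)`. Here `s` is the fixed square root of `q = |F|` in `C`, so that
`|𝔤|^{1/2} = s ^ dim_F 𝔤`. -/
def jacobiSum [Module F V] [IsScalarTower F E V] (s : C) (χ : Eˣ →* Cˣ) (B : EpsForm c ε V)
    (π : Representation C B.isometryGroup W) : W →ₗ[C] W :=
  (s ^ Module.finrank F B.lieAlgebra)⁻¹ • ∑ᶠ g : B.isometryGroup, jacobiKernel χ B g • π g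

variable (c ε) in
/-- The non-abelian Jacobi sum of a representation of `GL_E(V)`, that is, of the isometry group of
the zero form on `V`. -/
def jacobiSumGL [Module F V] [IsScalarTower F E V] (s : C) (χ : Eˣ →* Cˣ)
    (τ : Representation C (V ≃ₗ[E] V) W) : W →ₗ[C] W :=
  jacobiSum s χ (0 : EpsForm c ε V) (τ.comp (0 : EpsForm c ε V).isometryGroup.subtype)

/-- The character `χ^c : x ↦ χ(c x)`. -/
def conjChar (c : E ≃ₐ[F] E) (χ : Eˣ →* Cˣ) : Eˣ →* Cˣ :=
  χ.comp (Units.map (c : E →* E))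

/-- The character `χ^{1+c} : x ↦ χ(x · c x)`. -/
def onePlusConjChar (c : E ≃ₐ[F] E) (χ : Eˣ →* Cˣ) : Eˣ →* Cˣ :=
  χ * conjChar c χ

/-- The twist `τ ⊗ (ψ ∘ det)` of a representation `τ` of `GL_E(V)`. -/
def twist (τ : Representation C (V ≃ₗ[E] V) W) (ψ : Eˣ →* Cˣ) :
    Representation C (V ≃ₗ[E] V) W where
  toFun a := (ψ (LinearEquiv.det a) : C) • τ a
  map_one' := by simp
  map_mul' a b := by
    simp only [map_mul, Units.val_mul, smul_mul_smul_comm]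

end Jacobi

/-- A decomposition `V = X ⊕ V₀ ⊕ Y` in which `X` and `Y` are totally isotropic and `V₀` is
orthogonal to `X` and to `Y`. -/
structure Decomposition {c : E ≃ₐ[F] E} {ε : ℤˣ} {V : Type*} [AddCommGroup V] [Module E V]
    (B : EpsForm c ε V) where
  X : Submodule E V
  V₀ : Submodule E V
  Y : Submodule E V
  disjoint : Disjoint X Y
  isCompl : IsCompl V₀ (X ⊔ Y)
  isotropic_X : ∀ x ∈ X, ∀ x' ∈ X, B.form x x' = 0
  isotropic_Y : ∀ y ∈ Y, ∀ y' ∈ Y, B.form y y' = 0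
  orthogonal_X : ∀ v ∈ V₀, ∀ x ∈ X, B.form v x = 0
  orthogonal_Y : ∀ v ∈ V₀, ∀ y ∈ Y, B.form v y = 0

namespace Decomposition

variable {c : E ≃ₐ[F] E} {ε : ℤˣ} {V : Type*} [AddCommGroup V] [Module E V]
variable {B : EpsForm c ε V} (D : Decomposition B)

/-- `X` and `Y` are in duality: every linear functional on `X` is `x ↦ ⟨x, y⟩` for a unique
`y ∈ Y`. -/
def InDuality : Prop :=
  ∀ l : D.X →ₗ[E] E, ∃! y : D.Y, ∀ x : D.X, l x = B.form (x : V) (y : V)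

/-- The restriction of the form to `V₀`. -/
abbrev form₀ : EpsForm c ε D.V₀ := B.restrict D.V₀

/-- The parabolic subgroup of `G(V)` that stabilizes the flag `0 ⊂ X ⊂ X ⊕ V₀ ⊂ V`. -/
def parabolic : Subgroup B.isometryGroup where
  carrier := {g | D.X.map ((g : V ≃ₗ[E] V) : V →ₗ[E] V) = D.X ∧
    (D.X ⊔ D.V₀).map ((g : V ≃ₗ[E] V) : V →ₗ[E] V) = D.X ⊔ D.V₀}
  one_mem' := ⟨Submodule.map_id _, Submodule.map_id _⟩
  mul_mem' := by
    intro g h hg hh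
    have key : ∀ S : Submodule E V, S.map ((g : V ≃ₗ[E] V) : V →ₗ[E] V) = S →
        S.map ((h : V ≃ₗ[E] V) : V →ₗ[E] V) = S →
        S.map (((g * h : B.isometryGroup) : V ≃ₗ[E] V) : V →ₗ[E] V) = S := by
      intro S h1 h2
      have := Submodule.map_comp ((h : V ≃ₗ[E] V) : V →ₗ[E] V) ((g : V ≃ₗ[E] V) : V →ₗ[E] V) S
      rw [h2, h1] at this
      exact this
    exact ⟨key _ hg.1 hh.1, key _ hg.2 hh.2⟩
  inv_mem' := by
    intro g hg
    have key : ∀ S : Submodule E V, S.map ((g : V ≃ₗ[E] V) : V →ₗ[E] V) = S →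
        S.map (((g⁻¹ : B.isometryGroup) : V ≃ₗ[E] V) : V →ₗ[E] V) = S := by
      intro S h1
      have h2 := Submodule.map_comp ((g : V ≃ₗ[E] V) : V →ₗ[E] V)
        (((g⁻¹ : B.isometryGroup) : V ≃ₗ[E] V) : V →ₗ[E] V) S
      rw [h1] at h2
      rw [← h2]
      have h3 : (((g⁻¹ : B.isometryGroup) : V ≃ₗ[E] V) : V →ₗ[E] V) ∘ₗ
          ((g : V ≃ₗ[E] V) : V →ₗ[E] V) = LinearMap.id := by
        ext v
        exact (g : V ≃ₗ[E] V).symm_apply_apply v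
      rw [h3, Submodule.map_id]
    exact ⟨key _ hg.1, key _ hg.2⟩

theorem map_mem_X (p : D.parabolic) {x : V} (hx : x ∈ D.X) :
    ((p : B.isometryGroup) : V ≃ₗ[E] V) x ∈ D.X :=
  p.2.1.le (Submodule.mem_map_of_mem hx)

theorem map_mem_sup (p : D.parabolic) {v : V} (hv : v ∈ D.X ⊔ D.V₀) :
    ((p : B.isometryGroup) : V ≃ₗ[E] V) v ∈ D.X ⊔ D.V₀ :=
  p.2.2.le (Submodule.mem_map_of_mem hv)

/-- The component of a vector in `V₀` along `X ⊕ Y`. -/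
def proj₀ : V →ₗ[E] D.V₀ := Submodule.projectionOnto D.V₀ (D.X ⊔ D.Y) D.isCompl

theorem proj₀_V₀ (v : D.V₀) : D.proj₀ (v : V) = v :=
  Submodule.projectionOnto_apply_left D.isCompl v

theorem proj₀_X {x : V} (hx : x ∈ D.X) : D.proj₀ x = 0 :=
  Submodule.projectionOnto_apply_of_mem_right D.isCompl (Submodule.mem_sup_left hx)

/-- On `X ⊕ V₀`, a vector differs from its `V₀`-component by an element of `X`. -/
theorem exists_eq_add {v : V} (hv : v ∈ D.X ⊔ D.V₀) :
    ∃ x ∈ D.X, v = x + (D.proj₀ v : V) := by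
  obtain ⟨x, hx, w, hw, rfl⟩ := Submodule.mem_sup.mp hv
  refine ⟨x, hx, ?_⟩
  rw [map_add, D.proj₀_X hx, zero_add]
  exact congrArg (fun z : D.V₀ => x + (z : V)) (D.proj₀_V₀ ⟨w, hw⟩).symm

/-- The action of the parabolic subgroup on `X`. -/
def actXEnd : D.parabolic →* Module.End E D.X where
  toFun p := (((p : B.isometryGroup) : V ≃ₗ[E] V) : V →ₗ[E] V).restrict
    (fun _ hx => D.map_mem_X p hx)
  map_one' := by ext x; rfl
  map_mul' p p' := by ext x; rfl

/-- The `GL_E(X)`-component of the projection of the parabolic subgroup to its Levi part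
`GL_E(X) × G(V₀)`. -/
def leviX : D.parabolic →* (D.X ≃ₗ[E] D.X) :=
  (LinearMap.GeneralLinearGroup.generalLinearEquiv E D.X).toMonoidHom.comp D.actXEnd.toHomUnits

/-- The action of the parabolic subgroup on `(X ⊕ V₀) / X`, identified with `V₀`. -/
def actV₀End : D.parabolic →* Module.End E D.V₀ where
  toFun p := D.proj₀ ∘ₗ (((p : B.isometryGroup) : V ≃ₗ[E] V) : V →ₗ[E] V) ∘ₗ D.V₀.subtype
  map_one' := by
    ext v
    exact congrArg Subtype.val (D.proj₀_V₀ v)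
  map_mul' p p' := by
    ext v
    obtain ⟨x, hx, h⟩ := D.exists_eq_add
      (D.map_mem_sup p' (Submodule.mem_sup_right v.2 : (v : V) ∈ D.X ⊔ D.V₀))
    refine congrArg Subtype.val
      (?_ : D.proj₀ (((p : B.isometryGroup) : V ≃ₗ[E] V)
          (((p' : B.isometryGroup) : V ≃ₗ[E] V) (v : V))) =
        D.proj₀ (((p : B.isometryGroup) : V ≃ₗ[E] V)
          (D.proj₀ (((p' : B.isometryGroup) : V ≃ₗ[E] V) (v : V)) : V)))
    conv_lhs => rw [h]
    rw [map_add, map_add, D.proj₀_X (D.map_mem_X p hx), zero_add]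

theorem actV₀End_isometry (p : D.parabolic) (v w : D.V₀) :
    B.form (D.actV₀End p v : V) (D.actV₀End p w : V) = B.form (v : V) (w : V) := by
  obtain ⟨x, hx, h⟩ := D.exists_eq_add
    (D.map_mem_sup p (Submodule.mem_sup_right v.2 : (v : V) ∈ D.X ⊔ D.V₀))
  obtain ⟨x', hx', h'⟩ := D.exists_eq_add
    (D.map_mem_sup p (Submodule.mem_sup_right w.2 : (w : V) ∈ D.X ⊔ D.V₀))
  have e := (p : B.isometryGroup).2 (v : V) (w : V)
  rw [h, h'] at e
  have o : ∀ z : D.V₀, B.form x (z : V) = 0 := fun z => by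
    rw [B.symm (z : V) x, D.orthogonal_X z z.2 x hx]; simp
  rw [map_add (B.form), LinearMap.add_apply, map_add, map_add, D.isotropic_X x hx x' hx', o,
    D.orthogonal_X _ (D.proj₀ _).2 x' hx', add_zero, zero_add, zero_add] at e
  exact e

/-- The `G(V₀)`-component of the projection of the parabolic subgroup to its Levi part
`GL_E(X) × G(V₀)`. -/
def leviV₀ : D.parabolic →* D.form₀.isometryGroup :=
  ((LinearMap.GeneralLinearGroup.generalLinearEquiv E D.V₀).toMonoidHom.comp
    D.actV₀End.toHomUnits).codRestrict D.form₀.isometryGroup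
    (fun p v w => D.actV₀End_isometry p v w)

variable {C : Type*} [Field C] {Wτ W₀ : Type*} [AddCommGroup Wτ] [Module C Wτ]
  [AddCommGroup W₀] [Module C W₀]

/-- The representation `τ ⊠ π₀` of the Levi part `GL_E(X) × G(V₀)`, inflated to the parabolic
subgroup. -/
def inflation (τ : Representation C (D.X ≃ₗ[E] D.X) Wτ)
    (π₀ : Representation C D.form₀.isometryGroup W₀) :
    Representation C D.parabolic (Wτ ⊗[C] W₀) :=
  Representation.tprod (τ.comp D.leviX) (π₀.comp D.leviV₀)

/-- The parabolically induced representation `Ind_P^{G(V)}(τ ⊠ π₀)`: the functions `f` on `G(V)`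
with `f(p g) = (τ ⊠ π₀)(p) f(g)` for `p ∈ P`, on which `G(V)` acts by right translation. -/
abbrev parabolicInduction (τ : Representation C (D.X ≃ₗ[E] D.X) Wτ)
    (π₀ : Representation C D.form₀.isometryGroup W₀) :
    Representation C B.isometryGroup
      (Representation.coindV D.parabolic.subtype (D.inflation τ π₀)) :=
  Representation.coind D.parabolic.subtype (D.inflation τ π₀)

end Decomposition

end DoublingJacobi

end

open scoped TensorProduct

noncomputable section

namespace DoublingJacobi

/-! ### Class functions acting on induced representations. -/

section

section RepresentationTheory

variable {G C W : Type*} [Group G] [Field C] [AddCommGroup W] [Module C W]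

/-! Write κ(g) = χ(det(1+g)), extended by zero, and let N be the unipotent radical of P. Since κ is
a class function, its action on a representation induced from P is governed by its restriction to P
as soon as the sum of κ over gN vanishes for every g outside P (`sum_smul_coind`). Three
computations then give the product formula; `jacobiSum_parabolicInduction` assembles them for both
kinds of form.

Restriction to P. An element p acts by a on X, by b on V₀, and (nondegenerate case) on Y by the
contragredient of a. Triangularity and duality give det(1+p) = det(1+a) · det(1+b) · c(det(1+a)) ·
c(det a)⁻¹, so κ(p) is χ^{1+c}(det(1+a)) χ^{-c}(det a) times the kernel at b
(`jacobiKernel_parabolic`). Summing over P yields |N| times the product of the two unnormalized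
Jacobi sums. For the zero form there is no Y and no twist.

Vanishing off P. If g is not in P, some w in X lies outside (1+g)X. For h in gN with 1+h invertible,
the solution y of (1+h)y = w is then not in X. Averaging over the elements of N built from w
(transvections for the zero form, Eichler transformations otherwise) makes det(1+kh) a low-rank
perturbation of det(1+h). It runs through affine functions, or norms of affine functions, of a free
parameter, and rescaling the parameter kills the sum because χ, respectively χ^{1+c}, is nontrivial
(`finsum_jacobiKernel_eq_zero_of_form_eq_zero`, `finsum_jacobiKernel_eq_zero`).

Normalization. Counting skew forms by blocks, and using the truncated exponential onto N, gives
|𝔤(V)| = |𝔤𝔩(X)| |𝔤(V₀)| |N|² in the nondegenerate case (`natCard_lieAlgebra`); the zero form is a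
direct count. The square root absorbs exactly the factor |N|. -/

theorem finiteDimensional_of_isIrreducible [Finite G] (π : Representation C G W)
    [π.IsIrreducible] : FiniteDimensional C W := by
  have hnt : Nontrivial (Subrepresentation π) := IsSimpleOrder.toNontrivial
  have hW : ∃ v : W, v ≠ 0 := by
    by_contra! h
    refine (bot_ne_top (α := Subrepresentation π)) ?_
    apply Subrepresentation.toSubmodule_injective
    ext v
    rw [h v]
    exact ⟨fun _ => Submodule.zero_mem _, fun _ => Submodule.zero_mem _⟩
  obtain ⟨v, hv⟩ := hW
  -- The orbit of `v` is finite and spans a nonzero invariant subspace, so irreducibility makes it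
  -- span everything.
  let S : Subrepresentation π :=
    { toSubmodule := Submodule.span C (Set.range fun g => π g v)
      apply_mem_toSubmodule := by
        intro g w hw
        induction hw using Submodule.span_induction with
        | mem x hx =>
          obtain ⟨h, rfl⟩ := hx
          exact Submodule.subset_span ⟨g * h, by simp⟩
        | zero => simp
        | add x y _ _ hx hy => rw [map_add]; exact Submodule.add_mem _ hx hy
        | smul a x _ hx => rw [map_smul]; exact Submodule.smul_mem _ _ hx }
  have hvS : v ∈ S.toSubmodule := Submodule.subset_span ⟨1, by simp⟩
  have hS : S = ⊤ := by
    refine (IsSimpleOrder.eq_bot_or_eq_top S).resolve_left fun h => hv ?_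
    rw [h] at hvS
    exact (Submodule.mem_bot C).mp hvS
  have hS' : Submodule.span C (Set.range fun g => π g v) = ⊤ :=
    congrArg Subrepresentation.toSubmodule hS
  exact ⟨Submodule.fg_def.mpr ⟨_, Set.finite_range _, hS'⟩⟩

/-- Schur's lemma. -/
theorem exists_eq_smul_id_of_commute [Finite G] [IsAlgClosed C] (π : Representation C G W)
    [π.IsIrreducible] (T : W →ₗ[C] W) (hT : ∀ g, T ∘ₗ π g = π g ∘ₗ T) :
    ∃ a : C, T = a • LinearMap.id := by
  have := finiteDimensional_of_isIrreducible π
  let f : Representation.IntertwiningMap π π := ⟨T, hT⟩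
  obtain ⟨a, ha⟩ :=
    (Representation.IsIrreducible.algebraMap_intertwiningMap_bijective_of_isAlgClosed
      (ρ := π)).2 f
  refine ⟨a, ?_⟩
  ext w
  exact (congrArg (fun F : Representation.IntertwiningMap π π => F w) ha).symm

theorem sum_smul_commute [Fintype G] (κ : G → C) (hκ : ∀ g h, κ (h * g * h⁻¹) = κ g)
    (π : Representation C G W) (h : G) :
    (∑ g, κ g • π g) ∘ₗ π h = π h ∘ₗ ∑ g, κ g • π g := by
  have h1 : (∑ g, κ g • π g) = ∑ g, κ g • π (h * g * h⁻¹) := by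
    rw [← Equiv.sum_comp (MulAut.conj h).toEquiv (fun g => κ g • π g)]
    simp [hκ]
  conv_lhs => rw [h1]
  change (∑ g, κ g • π (h * g * h⁻¹)) * π h = π h * ∑ g, κ g • π g
  rw [Finset.sum_mul, Finset.mul_sum]
  refine Finset.sum_congr rfl fun g _ => ?_
  rw [smul_mul_assoc, mul_smul_comm, ← map_mul, ← map_mul]
  simp

/-- A class function whose sums over the left cosets `gN` with `g ∉ P` vanish acts on a
representation induced from `P`, on which `N` acts trivially, through its restriction to `P`. -/
theorem sum_smul_coind [Fintype G] {P : Subgroup G} [Fintype P] (N : Subgroup P) [Fintype N]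
    (σ : Representation C P W) (hσ : ∀ n ∈ N, σ n = 1)
    (κ : G → C) (hκ : ∀ g h, κ (h * g * h⁻¹) = κ g) (hN : (Nat.card N : C) ≠ 0)
    (hvan : ∀ g : G, g ∉ P → ∑ n : N, κ (g * ((n : P) : G)) = 0)
    (a : C) (ha : ∑ p : P, κ p • σ p = a • LinearMap.id) :
    ∑ g, κ g • Representation.coind P.subtype σ g = a • LinearMap.id := by
  classical
  ext f x
  obtain ⟨f, hf⟩ := f
  have hf' : ∀ (p : P) (y : G), f ((p : G) * y) = σ p (f y) := hf
  have e1 : ((∑ g, κ g • Representation.coind P.subtype σ g) ⟨f, hf⟩).1 x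
      = ∑ g, κ g • f (g * x) := by
    have : ((∑ g, κ g • Representation.coind P.subtype σ g) ⟨f, hf⟩).1 x
        = ∑ g, κ g • f (x * g) := by
      simp only [LinearMap.sum_apply, LinearMap.smul_apply, Submodule.coe_sum, Submodule.coe_smul,
        Finset.sum_apply, Pi.smul_apply]
      rfl
    -- Conjugating by `x` moves the summation variable to the left of `x`, where the covariance of
    -- `f` under P applies.
    rw [this, ← Equiv.sum_comp (MulAut.conj x).toEquiv (fun g => κ g • f (g * x))]
    refine Finset.sum_congr rfl fun g _ => ?_
    simp [hκ]
  have split : ∑ g, κ g • f (g * x)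
      = ∑ g, (if g ∈ P then κ g • f (g * x) else 0)
        + ∑ g, (if g ∈ P then 0 else κ g) • f (g * x) := by
    rw [← Finset.sum_add_distrib]
    refine Finset.sum_congr rfl fun g _ => ?_
    split_ifs <;> simp
  have inP : ∑ g, (if g ∈ P then κ g • f (g * x) else 0) = a • f x := by
    rw [← Finset.sum_filter, Finset.sum_subtype (p := fun g => g ∈ P) _ (by simp)
      (fun g => κ g • f (g * x))]
    have := congrArg (fun T : W →ₗ[C] W => T (f x)) ha
    simpa [LinearMap.sum_apply, hf'] using this
  have notP : ∑ g, (if g ∈ P then 0 else κ g) • f (g * x) = 0 := by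
    -- The value f(gx) does not change when g is replaced by ng with n in N. Averaging over such
    -- translations collects the sums of κ(ng) = κ(gn), which are the vanishing coset sums; the
    -- cutoff is harmless because N lies in P.
    set φ : G → C := fun g => if g ∈ P then 0 else κ g with hφ
    have hφN : ∀ g, ∑ n : N, φ (g * ((n : P) : G)) = 0 := by
      intro g
      by_cases hg : g ∈ P
      · refine Finset.sum_eq_zero fun n _ => ?_
        simp [hφ, P.mul_mem hg (n : P).2]
      · have : ∀ n : N, φ (g * ((n : P) : G)) = κ (g * ((n : P) : G)) := fun n => by
          simp [hφ, P.mul_mem_cancel_right (n : P).2, hg]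
        simp [this, hvan g hg]
    have hconj : ∀ (g : G) (n : N), φ (((n : P) : G) * g) = φ (g * ((n : P) : G)) := by
      intro g n
      have h1 : κ (((n : P) : G) * g) = κ (g * ((n : P) : G)) := by
        rw [← hκ (g * ((n : P) : G)) ((n : P) : G)]
        congr 1
        group
      simp [hφ, P.mul_mem_cancel_right (n : P).2, P.mul_mem_cancel_left (n : P).2, h1]
    have h2 : (Nat.card N : C) • ∑ g, φ g • f (g * x) = 0 := by
      calc (Nat.card N : C) • ∑ g, φ g • f (g * x)
          = ∑ n : N, ∑ g, φ (((n : P) : G) * g) • f (((n : P) : G) * g * x) := by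
            have : ∀ n : N, ∑ g, φ (((n : P) : G) * g) • f (((n : P) : G) * g * x)
                = ∑ g, φ g • f (g * x) := fun n =>
              Equiv.sum_comp (Equiv.mulLeft ((n : P) : G)) (fun g => φ g • f (g * x))
            simp only [this, Finset.sum_const, Finset.card_univ, Nat.card_eq_fintype_card]
            rw [Nat.cast_smul_eq_nsmul]
        _ = ∑ g, (∑ n : N, φ (g * ((n : P) : G))) • f (g * x) := by
            rw [Finset.sum_comm]
            refine Finset.sum_congr rfl fun g _ => ?_
            rw [Finset.sum_smul]
            refine Finset.sum_congr rfl fun n _ => ?_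
            rw [hconj, mul_assoc, hf', hσ n n.2, Module.End.one_apply]
        _ = 0 := by simp [hφN]
    exact (smul_eq_zero.mp h2).resolve_left hN
  rw [e1, split, inP, notP, add_zero]
  rfl

end RepresentationTheory

theorem sum_comp_eq_card_ker_nsmul {G H M : Type*} [Group G] [Group H] [Fintype G] [Fintype H]
    [AddCommMonoid M] (φ : G →* H) (hφ : Function.Surjective φ) (f : H → M) :
    ∑ g, f (φ g) = Nat.card φ.ker • ∑ h, f h := by
  classical
  rw [← Finset.sum_fiberwise_of_maps_to (g := φ) (t := Finset.univ) (by simp), Finset.smul_sum]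
  refine Finset.sum_congr rfl fun h _ => ?_
  obtain ⟨g₀, rfl⟩ := hφ h
  rw [Finset.sum_congr rfl (g := fun _ => f (φ g₀)) (by
    intro g hg; rw [(Finset.mem_filter.mp hg).2]), Finset.sum_const]
  congr 1
  rw [Nat.card_eq_fintype_card, Fintype.card_of_subtype
    ((Finset.univ.filter fun g => φ g = φ g₀).map (Equiv.mulLeft g₀⁻¹).toEmbedding),
    Finset.card_map]
  intro x
  simp only [Finset.mem_map_equiv, Finset.mem_filter, Finset.mem_univ, true_and,
    MonoidHom.mem_ker]
  simp [Equiv.mulLeft]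

/-- Each summand depends only on the image of p in G₁ × G₂, so every pair is counted as often as the
kernel has elements, and the sum over pairs factors as a tensor product of two scalars. -/
theorem sum_smul_tprod {G₁ G₂ P C W₁ W₂ : Type*} [Group G₁] [Group G₂] [Group P] [Field C]
    [AddCommGroup W₁] [Module C W₁] [AddCommGroup W₂] [Module C W₂]
    [Fintype G₁] [Fintype G₂] [Fintype P] (φ₁ : P →* G₁) (φ₂ : P →* G₂)
    (hφ : Function.Surjective (φ₁.prod φ₂))
    (π₁ : Representation C G₁ W₁) (π₂ : Representation C G₂ W₂) (κ : P → C) (κ₁ : G₁ → C)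
    (κ₂ : G₂ → C) (hκ : ∀ p, κ p = κ₁ (φ₁ p) * κ₂ (φ₂ p)) {a b : C}
    (h₁ : ∑ g, κ₁ g • π₁ g = a • LinearMap.id) (h₂ : ∑ g, κ₂ g • π₂ g = b • LinearMap.id) :
    ∑ p, κ p • Representation.tprod (π₁.comp φ₁) (π₂.comp φ₂) p =
      ((Nat.card (φ₁.prod φ₂).ker : C) * (a * b)) • LinearMap.id := by
  have e : ∀ p, κ p • Representation.tprod (π₁.comp φ₁) (π₂.comp φ₂) p =
      (fun x : G₁ × G₂ => TensorProduct.map (κ₁ x.1 • π₁ x.1) (κ₂ x.2 • π₂ x.2))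
        (φ₁.prod φ₂ p) := by
    intro p
    simp only [MonoidHom.prod_apply, TensorProduct.map_smul_left, TensorProduct.map_smul_right,
      smul_smul, hκ, Representation.tprod_apply,
      mul_comm (κ₁ _)]
    rfl
  rw [Finset.sum_congr rfl fun p _ => e p, sum_comp_eq_card_ker_nsmul (φ₁.prod φ₂) hφ
    (fun x : G₁ × G₂ => TensorProduct.map (κ₁ x.1 • π₁ x.1) (κ₂ x.2 • π₂ x.2)), mul_smul,
    Nat.cast_smul_eq_nsmul]
  congr 1
  rw [Fintype.sum_prod_type]
  have e2 : TensorProduct.map (∑ g, κ₁ g • π₁ g) (∑ g, κ₂ g • π₂ g) =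
      ∑ x, ∑ y, TensorProduct.map (κ₁ x • π₁ x) (κ₂ y • π₂ y) := by
    simp only [← TensorProduct.mapBilinear_apply, map_sum, LinearMap.sum_apply]
    exact Finset.sum_comm
  rw [← e2, h₁, h₂, TensorProduct.map_smul_left, TensorProduct.map_smul_right,
    TensorProduct.map_id, smul_smul]

end

/-! ### The Jacobi kernel and the reduction to three geometric inputs. -/

section

section Kernel

variable {F E : Type*} [Field F] [Field E] [Algebra F E] {c : E ≃ₐ[F] E} {ε : ℤˣ}
  {V : Type*} [AddCommGroup V] [Module E V] {C : Type*} [Field C]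

/-- A multiplicative character is zero at 0 and so absorbs the case distinction on the determinant.
This makes the kernel multiplicative in det(1+g) without side conditions. -/
theorem jacobiKernel_eq_ofUnitHom (χ : Eˣ →* Cˣ) (B : EpsForm c ε V) (g : B.isometryGroup)
    (hg : LinearMap.det (1 + ((g : V ≃ₗ[E] V) : V →ₗ[E] V)) ≠ 0 → g ∈ B.identityComponent) :
    jacobiKernel χ B g =
      MulChar.ofUnitHom χ (LinearMap.det (1 + ((g : V ≃ₗ[E] V) : V →ₗ[E] V))) := by
  unfold jacobiKernel
  split_ifs with h
  · exact (MulChar.ofUnitHom_coe χ (Units.mk0 _ h.2)).symm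
  · have h0 : LinearMap.det (1 + ((g : V ≃ₗ[E] V) : V →ₗ[E] V)) = 0 := by
      by_contra h0
      exact h ⟨hg h0, h0⟩
    rw [h0, MulChar.map_nonunit _ not_isUnit_zero]

theorem det_one_add_mul_inv (g h : V ≃ₗ[E] V) :
    LinearMap.det (1 + ((h * g * h⁻¹ : V ≃ₗ[E] V) : V →ₗ[E] V)) =
      LinearMap.det (1 + (g : V →ₗ[E] V)) := by
  rw [← LinearMap.det_conj (1 + (g : V →ₗ[E] V)) h]
  congr 1
  ext v
  change v + h (g (h.symm v)) = h (h.symm v + g (h.symm v))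
  rw [map_add, h.apply_symm_apply]

theorem jacobiKernel_conj (χ : Eˣ →* Cˣ) (B : EpsForm c ε V) (g h : B.isometryGroup) :
    jacobiKernel χ B (h * g * h⁻¹) = jacobiKernel χ B g := by
  have h1 : h * g * h⁻¹ ∈ B.identityComponent ↔ g ∈ B.identityComponent := by
    refine imp_congr_right fun _ => ?_
    have : LinearEquiv.det ((h * g * h⁻¹ : B.isometryGroup) : V ≃ₗ[E] V) =
        LinearEquiv.det (g : V ≃ₗ[E] V) := by
      simp only [Subgroup.coe_mul, Subgroup.coe_inv, map_mul, map_inv]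
      rw [mul_comm, inv_mul_cancel_left]
    rw [this]
  have h2 : LinearMap.det (1 + (((h * g * h⁻¹ : B.isometryGroup) : V ≃ₗ[E] V) : V →ₗ[E] V)) =
      LinearMap.det (1 + ((g : V ≃ₗ[E] V) : V →ₗ[E] V)) :=
    det_one_add_mul_inv (g : V ≃ₗ[E] V) (h : V ≃ₗ[E] V)
  unfold jacobiKernel
  by_cases hg : g ∈ B.identityComponent ∧
    LinearMap.det (1 + ((g : V ≃ₗ[E] V) : V →ₗ[E] V)) ≠ 0
  · rw [dif_pos hg, dif_pos ⟨h1.mpr hg.1, h2 ▸ hg.2⟩]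
    congr 3
  · rw [dif_neg hg, dif_neg]
    rwa [h1, h2]

end Kernel

instance finite_linearEquiv {E V : Type*} [Field E] [Finite E] [AddCommGroup V] [Module E V]
    [FiniteDimensional E V] : Finite (V ≃ₗ[E] V) :=
  have : Finite V := Module.finite_of_finite E
  DFunLike.finite _

section

variable {F E : Type*} [Field F] [Field E] [Algebra F E] {c : E ≃ₐ[F] E} {ε : ℤˣ}
  {V : Type*} [AddCommGroup V] [Module E V]
  {C : Type*} [Field C] {W : Type*} [AddCommGroup W] [Module C W]

instance twist_isIrreducible (τ : Representation C (V ≃ₗ[E] V) W) [h : τ.IsIrreducible]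
    (ψ : Eˣ →* Cˣ) : (twist τ ψ).IsIrreducible := by
  let e : Subrepresentation τ ≃o Subrepresentation (twist τ ψ) :=
    { toFun := fun S => ⟨S.toSubmodule, fun g v hv =>
        S.toSubmodule.smul_mem _ (S.apply_mem_toSubmodule g hv)⟩
      invFun := fun S => ⟨S.toSubmodule, fun g v hv => by
        have := S.toSubmodule.smul_mem (((ψ (LinearEquiv.det g))⁻¹ : Cˣ) : C)
          (S.apply_mem_toSubmodule g hv)
        have e : (((ψ (LinearEquiv.det g))⁻¹ : Cˣ) : C) • (twist τ ψ) g v = τ g v := by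
          change ((ψ (LinearEquiv.det g))⁻¹ : Cˣ) • ((ψ (LinearEquiv.det g)) : Cˣ) • τ g v = _
          rw [inv_smul_smul]
        rwa [e] at this⟩
      left_inv := fun S => rfl
      right_inv := fun S => rfl
      map_rel_iff' := Iff.rfl }
  exact e.symm.isSimpleOrder

theorem twist_one (τ : Representation C (V ≃ₗ[E] V) W) : twist τ 1 = τ := by
  ext g v
  change ((1 : Cˣ) : C) • τ g v = τ g v
  simp

/-- The general linear group is the isometry group of the zero form. -/
def isometryGroupZeroEquiv (c : E ≃ₐ[F] E) (ε : ℤˣ) (V : Type*) [AddCommGroup V] [Module E V] :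
    (0 : EpsForm c ε V).isometryGroup ≃* (V ≃ₗ[E] V) :=
  MulEquiv.ofBijective (0 : EpsForm c ε V).isometryGroup.subtype
    ⟨Subtype.val_injective, fun g => ⟨⟨g, fun _ _ => rfl⟩, rfl⟩⟩

/-- The zero form counts as nondegenerate only on the zero space, where the determinant is 1 anyway.
-/
theorem mem_identityComponent_of_form_eq_zero (B : EpsForm c ε V) (hB : B.form = 0)
    (g : B.isometryGroup) : g ∈ B.identityComponent := by
  rintro ⟨-, -, h⟩
  have : Subsingleton V := by
    refine subsingleton_of_forall_eq 0 fun x => ?_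
    by_contra hx
    obtain ⟨y, hy⟩ := h x hx
    simp [hB] at hy
  have h1 : (g : V ≃ₗ[E] V) = 1 := Subsingleton.elim _ _
  rw [h1, map_one]

variable [Module F V] [IsScalarTower F E V]

/-- Moving the twist from the representation into the kernel gives the shape in which the kernel of
G(V) restricts to the GL(X)-factor of the Levi part. -/
theorem jacobiSumGL_eq_sum [Fintype (V ≃ₗ[E] V)] (s : C) (χ ψ : Eˣ →* Cˣ)
    (τ : Representation C (V ≃ₗ[E] V) W) :
    jacobiSumGL c ε s χ (twist τ ψ) =
      (s ^ Module.finrank F (0 : EpsForm c ε V).lieAlgebra)⁻¹ • ∑ g : V ≃ₗ[E] V,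
        (MulChar.ofUnitHom χ (LinearMap.det (1 + (g : V →ₗ[E] V))) *
          (ψ (LinearEquiv.det g) : C)) • τ g := by
  unfold jacobiSumGL jacobiSum
  congr 1
  rw [← finsum_eq_sum_of_fintype, ← finsum_comp_equiv (isometryGroupZeroEquiv c ε V).toEquiv]
  refine finsum_congr fun g => ?_
  rw [jacobiKernel_eq_ofUnitHom χ _ g
    (fun _ => mem_identityComponent_of_form_eq_zero _ rfl g), mul_smul]
  rfl

theorem jacobiSum_eq_smul_of_sum_eq_smul (s : C) (χ : Eˣ →* Cˣ) (B : EpsForm c ε V)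
    [Fintype B.isometryGroup] (π : Representation C B.isometryGroup W) {a j : C}
    (h : ∑ g, jacobiKernel χ B g • π g = a • LinearMap.id)
    (hj : (s ^ Module.finrank F B.lieAlgebra)⁻¹ * a = j) :
    jacobiSum s χ B π = j • LinearMap.id := by
  rw [jacobiSum, finsum_eq_sum_of_fintype, h, smul_smul, hj]

variable [Finite E] [FiniteDimensional E V]

theorem exists_jacobiSum_eq_smul [IsAlgClosed C] (s : C) (χ : Eˣ →* Cˣ) (B : EpsForm c ε V)
    (π : Representation C B.isometryGroup W) [π.IsIrreducible] :
    ∃ j : C, jacobiSum s χ B π = j • LinearMap.id := by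
  have := Fintype.ofFinite B.isometryGroup
  obtain ⟨j, hj⟩ := exists_eq_smul_id_of_commute π _
    (sum_smul_commute (jacobiKernel χ B) (jacobiKernel_conj χ B) π)
  refine ⟨(s ^ Module.finrank F B.lieAlgebra)⁻¹ * j, ?_⟩
  rw [jacobiSum, finsum_eq_sum_of_fintype, hj, smul_smul]

theorem exists_jacobiSumGL_eq_smul [IsAlgClosed C] (s : C) (χ : Eˣ →* Cˣ)
    (τ : Representation C (V ≃ₗ[E] V) W) [h : τ.IsIrreducible] :
    ∃ j : C, jacobiSumGL c ε s χ τ = j • LinearMap.id := by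
  let e : Subrepresentation τ ≃o
      Subrepresentation (τ.comp (0 : EpsForm c ε V).isometryGroup.subtype) :=
    { toFun := fun S => ⟨S.toSubmodule, fun g v hv => S.apply_mem_toSubmodule (g : V ≃ₗ[E] V) hv⟩
      invFun := fun S => ⟨S.toSubmodule, fun g v hv =>
        S.apply_mem_toSubmodule
        (⟨g, fun _ _ => rfl⟩ : (0 : EpsForm c ε V).isometryGroup) hv⟩
      left_inv := fun S => rfl
      right_inv := fun S => rfl
      map_rel_iff' := Iff.rfl }
  have : Representation.IsIrreducible (τ.comp (0 : EpsForm c ε V).isometryGroup.subtype) :=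
    e.symm.isSimpleOrder
  exact exists_jacobiSum_eq_smul s χ (0 : EpsForm c ε V) _

theorem jacobiSum_subrepresentation (s : C) (χ : Eˣ →* Cˣ) (B : EpsForm c ε V)
    (ρ : Representation C B.isometryGroup W) {j : C}
    (hj : jacobiSum s χ B ρ = j • LinearMap.id) (π : Subrepresentation ρ) :
    jacobiSum s χ B π.toRepresentation = j • LinearMap.id := by
  have := Fintype.ofFinite B.isometryGroup
  ext w
  have h := congrArg (fun T : W →ₗ[C] W => T (w : W)) hj
  simp only [jacobiSum, finsum_eq_sum_of_fintype, LinearMap.smul_apply, LinearMap.sum_apply,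
    LinearMap.id_apply] at h ⊢
  rw [Submodule.coe_smul, Submodule.coe_smul, ← h, Submodule.coe_sum]
  rfl

/-- Here the representation theory is separated from the geometry, which enters only through
`hsurj`, `hκ`, `hvan` and `hdim`. The nondegenerate case takes χ' = χ^{1+c} and ψ = χ^{-c}; the zero
form takes χ' = χ and ψ = 1. -/
theorem jacobiSum_parabolicInduction [IsAlgClosed C] {B : EpsForm c ε V} (D : Decomposition B)
    {Wτ W₀ : Type*} [AddCommGroup Wτ] [Module C Wτ] [AddCommGroup W₀] [Module C W₀]
    (τ : Representation C (D.X ≃ₗ[E] D.X) Wτ) [τ.IsIrreducible]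
    (π₀ : Representation C D.form₀.isometryGroup W₀) [π₀.IsIrreducible]
    (s : C) (hs : s ≠ 0) (χ χ' ψ : Eˣ →* Cˣ)
    (hsurj : Function.Surjective (D.leviX.prod D.leviV₀))
    (hκ : ∀ p : D.parabolic, jacobiKernel χ B p =
      MulChar.ofUnitHom χ' (LinearMap.det (1 + (D.leviX p : D.X →ₗ[E] D.X))) *
        (ψ (LinearEquiv.det (D.leviX p)) : C) * jacobiKernel χ D.form₀ (D.leviV₀ p))
    (hvan : ∀ g : B.isometryGroup, g ∉ D.parabolic →
      ∑ᶠ n : (D.leviX.prod D.leviV₀).ker,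
        jacobiKernel χ B (g * ((n : D.parabolic) : B.isometryGroup)) = 0)
    (hdim : s ^ Module.finrank F B.lieAlgebra =
      s ^ Module.finrank F (0 : EpsForm c ε D.X).lieAlgebra *
        s ^ Module.finrank F D.form₀.lieAlgebra * (Nat.card (D.leviX.prod D.leviV₀).ker : C)) :
    ∃ jτ j₀ : C,
      jacobiSumGL c ε s χ' (twist τ ψ) = jτ • LinearMap.id ∧
      jacobiSum s χ D.form₀ π₀ = j₀ • LinearMap.id ∧
      jacobiSum s χ B (D.parabolicInduction τ π₀) = (jτ * j₀) • LinearMap.id ∧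
      ∀ π : Subrepresentation (D.parabolicInduction τ π₀),
        Representation.IsIrreducible (V := π.toSubmodule) π.toRepresentation →
          ∃ j : C, jacobiSum s χ B π.toRepresentation = j • LinearMap.id ∧ j = jτ * j₀ := by
  obtain ⟨jτ, hτ⟩ := exists_jacobiSumGL_eq_smul (c := c) (ε := ε) s χ' (twist τ ψ)
  obtain ⟨j₀, h₀⟩ := exists_jacobiSum_eq_smul s χ D.form₀ π₀
  have key : jacobiSum s χ B (D.parabolicInduction τ π₀) = (jτ * j₀) • LinearMap.id := by
    have := Fintype.ofFinite B.isometryGroup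
    have := Fintype.ofFinite D.parabolic
    have := Fintype.ofFinite (D.leviX.prod D.leviV₀).ker
    have := Fintype.ofFinite D.form₀.isometryGroup
    have := Fintype.ofFinite (D.X ≃ₗ[E] D.X)
    have hsn : ∀ n : ℕ, s ^ n ≠ 0 := fun n => pow_ne_zero n hs
    -- The order of N is a factor of a power of the nonzero element `s`, hence invertible in C.
    have hN : (Nat.card (D.leviX.prod D.leviV₀).ker : C) ≠ 0 := by
      intro h
      rw [h, mul_zero] at hdim
      exact hsn _ hdim
    have h1 := hτ
    rw [jacobiSumGL_eq_sum, inv_smul_eq_iff₀ (hsn _), smul_smul] at h1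
    have h2 := h₀
    rw [jacobiSum, finsum_eq_sum_of_fintype, inv_smul_eq_iff₀ (hsn _), smul_smul] at h2
    have h3 := sum_smul_tprod D.leviX D.leviV₀ hsurj τ π₀ (fun p => jacobiKernel χ B p) _ _
      hκ h1 h2
    have h4 := sum_smul_coind (D.leviX.prod D.leviV₀).ker (D.inflation τ π₀) (by
        intro n hn
        have hn' : D.leviX n = 1 ∧ D.leviV₀ n = 1 := by
          simpa [MonoidHom.mem_ker, Prod.ext_iff] using hn
        change TensorProduct.map (τ (D.leviX n)) (π₀ (D.leviV₀ n)) = 1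
        rw [hn'.1, hn'.2, map_one, map_one]
        exact TensorProduct.map_id)
      (jacobiKernel χ B) (jacobiKernel_conj χ B) hN
      (fun g hg => by rw [← finsum_eq_sum_of_fintype]; exact hvan g hg) _ h3
    refine jacobiSum_eq_smul_of_sum_eq_smul s χ B _ h4 ?_
    rw [hdim]
    have ha := hsn (Module.finrank F (0 : EpsForm c ε D.X).lieAlgebra)
    have hb := hsn (Module.finrank F D.form₀.lieAlgebra)
    field_simp
  exact ⟨jτ, j₀, hτ, h₀, key, fun π _ =>
    ⟨jτ * j₀, jacobiSum_subrepresentation s χ B _ key π, rfl⟩⟩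

end

end

/-! ### Vanishing character sums and determinants of low-rank perturbations. -/

section

section Sums

/-- Averaging the coset sum over right translations by the family `k` replaces it by inner sums over
`k`; conjugation invariance moves each `k i` to the left of g·n, where the perturbed determinant can
be computed. -/
theorem sum_mul_left_coset_eq_zero {G N I C : Type*} [Group G] [Group N] [Fintype N] [Fintype I]
    [Field C] (j : N →* G) (κ : G → C) (hκ : ∀ g h, κ (h * g * h⁻¹) = κ g) (k : I → N)
    (hk : ∀ i₀, ∃ e : I ≃ I, ∀ i, k i₀ * k i = k (e i)) (hI : (Fintype.card I : C) ≠ 0) (g : G)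
    (hvan : ∀ n, κ (g * j n) ≠ 0 → ∑ i, κ (j (k i) * (g * j n)) = 0) :
    ∑ n, κ (g * j n) = 0 := by
  have inner : ∀ n, ∑ i, κ (g * j (n * k i)) = 0 := by
    intro n
    -- The hypothesis `hvan` is available only at points where κ is nonzero, i.e. in the application
    -- where 1+h is invertible. If such a point occurs in the inner sum, closure of the family under
    -- multiplication allows it to serve as the new base point.
    by_cases h : ∀ i, κ (g * j (n * k i)) = 0
    · exact Finset.sum_eq_zero fun i _ => h i
    push Not at h
    obtain ⟨i₀, hi₀⟩ := h
    obtain ⟨e, he⟩ := hk i₀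
    rw [← Equiv.sum_comp e, ← hvan _ hi₀]
    refine Finset.sum_congr rfl fun i _ => ?_
    rw [← he, ← hκ _ (j (k i))]
    congr 1
    simp only [map_mul]
    group
  have h : (Fintype.card I : C) * ∑ n, κ (g * j n) = 0 := by
    calc (Fintype.card I : C) * ∑ n, κ (g * j n) = ∑ i, ∑ n, κ (g * j (n * k i)) := by
          have : ∀ i, ∑ n, κ (g * j (n * k i)) = ∑ n, κ (g * j n) := fun i =>
            Equiv.sum_comp (Equiv.mulRight (k i)) (fun n => κ (g * j n))
          rw [Finset.sum_congr rfl fun i _ => this i, Finset.sum_const, Finset.card_univ,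
            nsmul_eq_mul]
      _ = 0 := by
          rw [Finset.sum_comm]
          exact Finset.sum_eq_zero fun n _ => inner n
  exact (mul_eq_zero.mp h).resolve_left hI

/-- A translation removes the constant 1 because a nonzero functional takes that value; dilation by
t then multiplies the sum by ζ ≠ 1. -/
theorem sum_one_add_eq_zero {E U C : Type*} [Field E] [AddCommGroup U] [Module E U] [Fintype U]
    [Field C] (l : U →ₗ[E] E) (hl : l ≠ 0) (Φ : E → C) (t : E) (ht : t ≠ 0) (ζ : C) (hζ : ζ ≠ 1)
    (hΦ : ∀ x, Φ (t * x) = ζ * Φ x) :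
    ∑ v, Φ (1 + l v) = 0 := by
  obtain ⟨v₀, hv₀⟩ : ∃ v, l v = 1 := by
    obtain ⟨v, hv⟩ := DFunLike.ne_iff.mp hl
    exact ⟨(l v)⁻¹ • v, by rw [map_smul, smul_eq_mul]; exact inv_mul_cancel₀ hv⟩
  have h1 : ∑ v, Φ (1 + l v) = ∑ v, Φ (l v) := by
    rw [← Equiv.sum_comp (Equiv.addLeft v₀) (fun v => Φ (l v))]
    simp [hv₀]
  have h2 : ∑ v, Φ (l v) = ζ * ∑ v, Φ (l v) := by
    conv_lhs => rw [← Equiv.sum_comp (LinearEquiv.smulOfNeZero E U t ht).toEquiv]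
    rw [Finset.mul_sum]
    refine Finset.sum_congr rfl fun v _ => ?_
    rw [← hΦ]
    simp
  rw [h1]
  have h3 : (1 - ζ) * ∑ v, Φ (l v) = 0 := by linear_combination h2
  exact (mul_eq_zero.mp h3).resolve_left (sub_ne_zero.mpr hζ.symm)

end Sums

section Determinants

variable {E V : Type*} [Field E] [AddCommGroup V] [Module E V] [FiniteDimensional E V]

/-- Factoring out A on the left leaves a transvection along y. Only a preimage of w is needed, not
invertibility of A. -/
theorem det_add_smulRight (A : V →ₗ[E] V) (f : V →ₗ[E] E) {w y : V} (hy : A y = w) :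
    LinearMap.det (A + f.smulRight w) = LinearMap.det A * (1 + f y) := by
  rw [← LinearMap.transvection.det f y, ← LinearMap.det_comp]
  congr 1
  ext x
  simp [LinearMap.transvection.apply, hy]

/-- After factoring out A, the identity det(1+PQ) = det(1+QP) reduces the rank-two perturbation to a
2×2 determinant. -/
theorem det_add_smulRight_add_smulRight (A : V →ₗ[E] V) (f₁ f₂ : V →ₗ[E] E) {w v y u : V}
    (hy : A y = w) (hu : A u = v) :
    LinearMap.det (A + f₁.smulRight w + f₂.smulRight v) =
      LinearMap.det A * ((1 + f₁ y) * (1 + f₂ u) - f₁ u * f₂ y) := by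
  let b := Module.finBasis E V
  let P : (Fin 2 → E) →ₗ[E] V := (LinearMap.proj 0).smulRight y + (LinearMap.proj 1).smulRight u
  let Q : V →ₗ[E] (Fin 2 → E) := LinearMap.pi ![f₁, f₂]
  have h1 : A + f₁.smulRight w + f₂.smulRight v = A ∘ₗ (LinearMap.id + P ∘ₗ Q) := by
    ext x
    simp [P, Q, hy, hu, add_assoc]
  have h2 : LinearMap.det (LinearMap.id + P ∘ₗ Q) = LinearMap.det (LinearMap.id + Q ∘ₗ P) := by
    let b₂ := Pi.basisFun E (Fin 2)
    rw [← LinearMap.det_toMatrix b, ← LinearMap.det_toMatrix b₂, map_add, map_add,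
      LinearMap.toMatrix_comp b b₂ b, LinearMap.toMatrix_comp b₂ b b₂, LinearMap.toMatrix_id,
      LinearMap.toMatrix_id, Matrix.det_one_add_mul_comm]
  rw [h1, LinearMap.det_comp, h2, ← LinearMap.det_toMatrix (Pi.basisFun E (Fin 2)),
    Matrix.det_fin_two]
  simp [P, Q]

end Determinants

theorem natCast_card_ne_zero {F M C : Type*} [Field F] [Finite F] [Field C]
    (hC : (Nat.card F : C) ≠ 0) [AddCommGroup M] [Module F M] [Finite M] :
    (Nat.card M : C) ≠ 0 := by
  have : Module.Finite F M := Module.Finite.of_finite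
  rw [Module.natCard_eq_pow_finrank (K := F)]
  push_cast
  exact pow_ne_zero _ hC

namespace Decomposition

variable {F : Type*} {E : Type*} [Field F] [Field E] [Algebra F E]
  {c : E ≃ₐ[F] E} {ε : ℤˣ} {V : Type*} [AddCommGroup V] [Module E V]
  {B : EpsForm c ε V} (D : Decomposition B)

theorem leviX_apply (p : D.parabolic) (x : D.X) :
    (D.leviX p x : V) = ((p : B.isometryGroup) : V ≃ₗ[E] V) x := rfl

theorem leviV₀_apply (p : D.parabolic) (v : D.V₀) :
    (D.leviV₀ p : D.V₀ ≃ₗ[E] D.V₀) v = D.proj₀ (((p : B.isometryGroup) : V ≃ₗ[E] V) v) := rfl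

theorem mem_ker_levi_iff (p : D.parabolic) :
    p ∈ (D.leviX.prod D.leviV₀).ker ↔
      (∀ x ∈ D.X, ((p : B.isometryGroup) : V ≃ₗ[E] V) x = x) ∧
      (∀ v ∈ D.V₀, ((p : B.isometryGroup) : V ≃ₗ[E] V) v - v ∈ D.X) := by
  have h1 : p ∈ (D.leviX.prod D.leviV₀).ker ↔ D.leviX p = 1 ∧ D.leviV₀ p = 1 := by
    simp [MonoidHom.mem_ker, Prod.ext_iff]
  rw [h1]
  refine and_congr ⟨fun h x hx => ?_, fun h => ?_⟩ ⟨fun h v hv => ?_, fun h => ?_⟩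
  · exact congrArg (fun a : D.X ≃ₗ[E] D.X => (a ⟨x, hx⟩ : V)) h
  · exact LinearEquiv.ext fun x => Subtype.ext (h x x.2)
  · have h2 : D.proj₀ (((p : B.isometryGroup) : V ≃ₗ[E] V) v) = ⟨v, hv⟩ :=
      congrArg (fun a : D.form₀.isometryGroup => (a : D.V₀ ≃ₗ[E] D.V₀) ⟨v, hv⟩) h
    obtain ⟨x, hx, h3⟩ := D.exists_eq_add (D.map_mem_sup p (Submodule.mem_sup_right hv))
    rw [h3, h2, add_sub_cancel_right]
    exact hx
  · refine Subtype.ext (LinearEquiv.ext fun v => ?_)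
    have h2 : D.proj₀ (((p : B.isometryGroup) : V ≃ₗ[E] V) v - v) = 0 := D.proj₀_X (h v v.2)
    rw [map_sub, D.proj₀_V₀, sub_eq_zero] at h2
    exact h2

/-- The element of the unipotent radical given by an isometry that fixes `X` pointwise and acts
trivially on `(X ⊕ V₀) / X`. -/
def unipotentMk [FiniteDimensional E V] (g : B.isometryGroup)
    (h₁ : ∀ x ∈ D.X, (g : V ≃ₗ[E] V) x = x) (h₂ : ∀ v ∈ D.V₀, (g : V ≃ₗ[E] V) v - v ∈ D.X) :
    (D.leviX.prod D.leviV₀).ker :=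
  have hX : D.X.map ((g : V ≃ₗ[E] V) : V →ₗ[E] V) ≤ D.X := by
    rintro _ ⟨x, hx, rfl⟩
    exact (h₁ x hx).symm ▸ hx
  have hU : (D.X ⊔ D.V₀).map ((g : V ≃ₗ[E] V) : V →ₗ[E] V) ≤ D.X ⊔ D.V₀ := by
    rw [Submodule.map_sup]
    refine sup_le (hX.trans le_sup_left) ?_
    rintro _ ⟨v, hv, rfl⟩
    have := Submodule.add_mem_sup (h₂ v hv) hv
    rwa [sub_add_cancel] at this
  ⟨⟨g, Submodule.eq_of_le_of_finrank_eq hX (LinearEquiv.finrank_map_eq (g : V ≃ₗ[E] V) _),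
    Submodule.eq_of_le_of_finrank_eq hU (LinearEquiv.finrank_map_eq (g : V ≃ₗ[E] V) _)⟩,
    (D.mem_ker_levi_iff _).mpr ⟨h₁, h₂⟩⟩

/-- If X were contained in (1+g)X, the two would agree by dimension, and then gX would lie in X. -/
theorem exists_mem_X_notMem_map [FiniteDimensional E V] (g : B.isometryGroup)
    (hg : D.X.map ((g : V ≃ₗ[E] V) : V →ₗ[E] V) ≠ D.X) :
    ∃ w ∈ D.X, ∀ x ∈ D.X, x + (g : V ≃ₗ[E] V) x ≠ w := by
  by_contra! h
  apply hg
  have h1 : D.X ≤ D.X.map (1 + ((g : V ≃ₗ[E] V) : V →ₗ[E] V)) := by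
    intro w hw
    obtain ⟨x, hx, e⟩ := h w hw
    exact ⟨x, hx, e⟩
  have h2 := Submodule.eq_of_le_of_finrank_le h1 (Submodule.finrank_map_le _ _)
  refine Submodule.eq_of_le_of_finrank_eq ?_ (LinearEquiv.finrank_map_eq (g : V ≃ₗ[E] V) _)
  rintro _ ⟨x, hx, rfl⟩
  have h3 : x + (g : V ≃ₗ[E] V) x ∈ D.X := by
    rw [h2]
    exact ⟨x, hx, rfl⟩
  have := D.X.sub_mem h3 hx
  rwa [add_sub_cancel_left] at this

end Decomposition

end

/-! ### Vanishing off the parabolic subgroup for the zero form. -/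

section

namespace Decomposition

variable {F : Type*} {E : Type*} [Field F] [Field E] [Algebra F E]
  {c : E ≃ₐ[F] E} {ε : ℤˣ} {V : Type*} [AddCommGroup V] [Module E V]
  {B : EpsForm c ε V} (D : Decomposition B)

theorem sup_eq_top (hY : D.Y = ⊥) : D.X ⊔ D.V₀ = ⊤ := by
  have := D.isCompl.sup_eq_top
  rwa [hY, sup_bot_eq, sup_comm] at this

variable [FiniteDimensional E V]

/-- The solution `y` of `(1 + h) y = w`, for `h` in the left coset `gN`, does not lie in `X` if
`w` does not lie in `(1 + g) X`. -/
theorem exists_notMem_X_add_apply_eq {g : B.isometryGroup} {w : V}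
    (hwg : ∀ x ∈ D.X, x + (g : V ≃ₗ[E] V) x ≠ w)
    (n : (D.leviX.prod D.leviV₀).ker)
    (hdet : LinearMap.det (1 + (((g * ((n : D.parabolic) : B.isometryGroup) : B.isometryGroup) :
      V ≃ₗ[E] V) : V →ₗ[E] V)) ≠ 0) :
    ∃ y ∉ D.X, y + ((g * ((n : D.parabolic) : B.isometryGroup) : B.isometryGroup) :
      V ≃ₗ[E] V) y = w := by
  obtain ⟨y, hy⟩ := (LinearMap.equivOfDetNeZero _ hdet).surjective w
  refine ⟨y, fun hyX => hwg y hyX ?_, hy⟩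
  have h1 := ((D.mem_ker_levi_iff _).mp n.2).1 y hyX
  have h2 : y + (g : V ≃ₗ[E] V) ((((n : D.parabolic) : B.isometryGroup) : V ≃ₗ[E] V) y) = w := hy
  rwa [h1] at h2

/-- The averaging family consists of the transvections x ↦ x + μ(x)w with μ vanishing on X. They
multiply det(1+h) by 1 − μ(y), and μ ↦ μ(y) is a nonzero functional since y is not in X. -/
theorem finsum_jacobiKernel_eq_zero_of_form_eq_zero [Finite F] [Finite E] {C : Type*} [Field C]
    (hC : (Nat.card F : C) ≠ 0) (χ : Eˣ →* Cˣ) (hχ : χ ≠ 1) (hB : B.form = 0) (hY : D.Y = ⊥)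
    (g : B.isometryGroup) (hg : g ∉ D.parabolic) :
    ∑ᶠ n : (D.leviX.prod D.leviV₀).ker,
      jacobiKernel χ B (g * ((n : D.parabolic) : B.isometryGroup)) = 0 := by
  have := Fintype.ofFinite (D.leviX.prod D.leviV₀).ker
  have hfinV : Finite V := Module.finite_of_finite E
  have : Finite (Module.Dual E V) := Module.finite_of_finite E
  have := Fintype.ofFinite D.X.dualAnnihilator
  have hgX : D.X.map ((g : V ≃ₗ[E] V) : V →ₗ[E] V) ≠ D.X := by
    refine fun h => hg ⟨h, ?_⟩
    rw [D.sup_eq_top hY]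
    exact Submodule.map_top _ |>.trans (LinearEquiv.range _)
  obtain ⟨w, hw, hwg⟩ := D.exists_mem_X_notMem_map g hgX
  have hker : ∀ h : B.isometryGroup, jacobiKernel χ B h =
      MulChar.ofUnitHom χ (LinearMap.det (1 + ((h : V ≃ₗ[E] V) : V →ₗ[E] V))) := fun h =>
    jacobiKernel_eq_ofUnitHom χ B h fun _ => mem_identityComponent_of_form_eq_zero B hB h
  have hμ : ∀ μ : D.X.dualAnnihilator, ∀ x ∈ D.X, (μ : Module.Dual E V) x = 0 := fun μ x hx =>
    (Submodule.mem_dualAnnihilator _).mp μ.2 x hx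
  let T : D.X.dualAnnihilator → B.isometryGroup := fun μ =>
    ⟨LinearEquiv.transvection (hμ μ w hw), fun x y => by simp [hB]⟩
  have hT : ∀ μ v, (T μ : V ≃ₗ[E] V) v = v + (μ : Module.Dual E V) v • w := fun μ v =>
    LinearEquiv.transvection.apply (hμ μ w hw) v
  let k : D.X.dualAnnihilator → (D.leviX.prod D.leviV₀).ker := fun μ =>
    D.unipotentMk (T μ) (fun x hx => by rw [hT, hμ μ x hx, zero_smul, add_zero])
      (fun v _ => by rw [hT, add_sub_cancel_left]; exact D.X.smul_mem _ hw)
  rw [finsum_eq_sum_of_fintype]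
  refine sum_mul_left_coset_eq_zero
    (D.parabolic.subtype.comp (D.leviX.prod D.leviV₀).ker.subtype) (jacobiKernel χ B)
    (jacobiKernel_conj χ B) k (fun μ₀ => ⟨Equiv.addLeft μ₀, fun μ => ?_⟩) ?_ g
    (fun n hn => ?_)
  · refine Subtype.ext (Subtype.ext (Subtype.ext (LinearEquiv.ext fun v => ?_)))
    change (T μ₀ : V ≃ₗ[E] V) ((T μ : V ≃ₗ[E] V) v) = (T (μ₀ + μ) : V ≃ₗ[E] V) v
    have h1 : ((μ₀ + μ : D.X.dualAnnihilator) : Module.Dual E V) v =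
      (μ₀ : Module.Dual E V) v + (μ : Module.Dual E V) v := rfl
    rw [hT, hT, hT, map_add, map_smul, hμ μ₀ w hw, h1]
    simp only [smul_zero, add_zero, add_smul]
    abel
  · rw [← Nat.card_eq_fintype_card]
    -- Viewed over F, the index set has order a power of q, which is nonzero in C.
    let := Module.compHom D.X.dualAnnihilator (algebraMap F E)
    exact natCast_card_ne_zero hC
  · set h : B.isometryGroup := g * ((n : D.parabolic) : B.isometryGroup) with hh
    change jacobiKernel χ B h ≠ 0 at hn
    change ∑ μ, jacobiKernel χ B (T μ * h) = 0
    have hdet : LinearMap.det (1 + ((h : V ≃ₗ[E] V) : V →ₗ[E] V)) ≠ 0 := by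
      rintro h0
      rw [hker, h0] at hn
      exact hn (MulChar.map_nonunit _ not_isUnit_zero)
    obtain ⟨y, hyX, hy⟩ := D.exists_notMem_X_add_apply_eq hwg n hdet
    set d := LinearMap.det (1 + ((h : V ≃ₗ[E] V) : V →ₗ[E] V)) with hd
    have hdetk : ∀ μ : D.X.dualAnnihilator,
        LinearMap.det (1 + (((T μ * h : B.isometryGroup) : V ≃ₗ[E] V) : V →ₗ[E] V)) =
          d * (1 + -(μ : Module.Dual E V) y) := by
      intro μ
      have h1 : (1 + (((T μ * h : B.isometryGroup) : V ≃ₗ[E] V) : V →ₗ[E] V)) =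
          (1 + ((h : V ≃ₗ[E] V) : V →ₗ[E] V)) +
            ((μ : Module.Dual E V) ∘ₗ ((h : V ≃ₗ[E] V) : V →ₗ[E] V)).smulRight w := by
        ext x
        change x + (T μ : V ≃ₗ[E] V) ((h : V ≃ₗ[E] V) x) = _
        rw [hT, ← add_assoc]
        rfl
      rw [h1, det_add_smulRight _ _ hy]
      have h2 : (h : V ≃ₗ[E] V) y = w - y := eq_sub_of_add_eq' hy
      change d * (1 + (μ : Module.Dual E V) ((h : V ≃ₗ[E] V) y)) = _
      rw [h2, map_sub, hμ μ w hw, zero_sub]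
    obtain ⟨t, ht⟩ := DFunLike.ne_iff.mp hχ
    let l : D.X.dualAnnihilator →ₗ[E] E :=
      -((LinearMap.applyₗ y : Module.Dual E V →ₗ[E] E) ∘ₗ D.X.dualAnnihilator.subtype)
    have hl : l ≠ 0 := by
      obtain ⟨f, hf, hfX⟩ := Submodule.exists_le_ker_of_notMem hyX
      intro h0
      have h1 := congrArg (fun L : D.X.dualAnnihilator →ₗ[E] E => L
        ⟨f, (Submodule.mem_dualAnnihilator _).mpr fun x hx => hfX hx⟩) h0
      simp [l] at h1
      exact hf h1
    have := sum_one_add_eq_zero (U := D.X.dualAnnihilator) l hl (fun x => MulChar.ofUnitHom χ (d * x)) t t.ne_zero (χ t)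
      (by simpa using ht) (fun x => by
        rw [← MulChar.ofUnitHom_coe, ← map_mul]
        congr 1
        ring)
    rw [← this]
    refine Finset.sum_congr rfl fun μ _ => ?_
    rw [hker, hdetk]
    rfl

end Decomposition

end

/-! ### Determinants of adjoint maps and Eichler transformations. -/

section

/-- The determinants of endomorphisms that are related through a perfect sesquilinear pairing. -/
theorem det_mul_conj_det_of_pairing {E V₁ V₂ : Type*} [Field E] [AddCommGroup V₁] [Module E V₁]
    [FiniteDimensional E V₁] [AddCommGroup V₂] [Module E V₂] [FiniteDimensional E V₂]
    {σ : E →+* E} (β : V₁ →ₗ[E] V₂ →ₛₗ[σ] E) (hβ : ∀ x, β x = 0 → x = 0)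
    (hdim : Module.finrank E V₁ = Module.finrank E V₂)
    (f : V₁ →ₗ[E] V₁) (g₁ g₂ : V₂ →ₗ[E] V₂) (h : ∀ x y, β (f x) (g₁ y) = β x (g₂ y)) :
    LinearMap.det f * σ (LinearMap.det g₁) = σ (LinearMap.det g₂) := by
  let b₁ := Module.finBasis E V₁
  let b₂ := (Module.finBasis E V₂).reindex (finCongr hdim.symm)
  let M := LinearMap.toMatrix b₁ b₁ f
  let N : (V₂ →ₗ[E] V₂) → Matrix _ _ E := fun g => (LinearMap.toMatrix b₂ b₂ g).map σ
  let G : Matrix (Fin (Module.finrank E V₁)) (Fin (Module.finrank E V₁)) E :=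
    Matrix.of fun i j => β (b₁ i) (b₂ j)
  have hG : G.det ≠ 0 := by
    intro h0
    obtain ⟨v, hv, hvG⟩ := Matrix.exists_vecMul_eq_zero_iff.mpr h0
    apply hv
    have hx : β (∑ i, v i • b₁ i) = 0 := by
      refine b₂.ext fun j => ?_
      have := congrFun hvG j
      simpa [Matrix.vecMul, dotProduct, G] using this
    have h1 := hβ _ hx
    exact funext fun i => Fintype.linearIndependent_iff.mp b₁.linearIndependent v h1 i
  -- The relation between the maps, written on bases through the Gram matrix `G`; its nonzero
  -- determinant cancels.
  have hmat : M.transpose * G * N g₁ = G * N g₂ := by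
    ext i j
    have h1 := h (b₁ i) (b₂ j)
    rw [← b₁.sum_repr (f (b₁ i)), ← b₂.sum_repr (g₁ (b₂ j)), ← b₂.sum_repr (g₂ (b₂ j))] at h1
    simp only [map_sum, LinearMap.sum_apply, map_smul, LinearMap.smul_apply,
      LinearMap.map_smulₛₗ, smul_eq_mul] at h1
    simp only [Matrix.mul_apply, Matrix.transpose_apply, M, N, G, Matrix.map_apply,
      LinearMap.toMatrix_apply, Matrix.of_apply, Finset.sum_mul]
    calc _ = _ := Finset.sum_congr rfl fun k _ => by
          rw [Finset.mul_sum]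
          exact Finset.sum_congr rfl fun l _ => by ring
      _ = _ := h1
      _ = _ := Finset.sum_congr rfl fun k _ => by ring
  have hdet := congrArg Matrix.det hmat
  have hN : ∀ g, (N g).det = σ (LinearMap.det g) := fun g => by
    change ((LinearMap.toMatrix b₂ b₂ g).map σ).det = _
    rw [← RingHom.mapMatrix_apply, ← RingHom.map_det, LinearMap.det_toMatrix]
  rw [Matrix.det_mul, Matrix.det_mul, Matrix.det_mul, Matrix.det_transpose, hN, hN,
    LinearMap.det_toMatrix] at hdet
  refine mul_left_cancel₀ hG ?_
  linear_combination hdet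

variable {F : Type*} {E : Type*} [Field F] [Field E] [Algebra F E]

theorem algEquiv_apply_of_finrank_eq_one (h : Module.finrank F E = 1) (c : E ≃ₐ[F] E) (x : E) :
    c x = x := by
  have hx : x ∈ (⊥ : Subalgebra F E) := by
    rw [Subalgebra.bot_eq_top_iff_finrank_eq_one.mpr h]
    exact Algebra.mem_top
  obtain ⟨a, rfl⟩ := Algebra.mem_bot.mp hx
  exact c.commutes a

/-- In degree 2 there are at most two automorphisms, so the square of any of them is the identity.
-/
theorem algEquiv_apply_apply (h : Module.finrank F E = 1 ∨ Module.finrank F E = 2)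
    (c : E ≃ₐ[F] E) (x : E) : c (c x) = x := by
  rcases h with h | h
  · simp only [algEquiv_apply_of_finrank_eq_one h]
  · have : FiniteDimensional F E := FiniteDimensional.of_finrank_pos (by omega)
    have hcard : Nat.card (E ≃ₐ[F] E) ≤ 2 := by
      rw [Nat.card_eq_fintype_card, ← h]
      exact AlgEquiv.card_le
    have hpos : 0 < Nat.card (E ≃ₐ[F] E) := Nat.card_pos
    have h1 : c ^ Nat.card (E ≃ₐ[F] E) = 1 := pow_card_eq_one'
    have h2 : c ^ 2 = 1 := by
      obtain h3 | h3 : Nat.card (E ≃ₐ[F] E) = 1 ∨ Nat.card (E ≃ₐ[F] E) = 2 := by omega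
      · rw [h3, pow_one] at h1
        rw [h1, one_pow]
      · rwa [h3] at h1
    rw [pow_two] at h2
    exact congrArg (fun d : E ≃ₐ[F] E => d x) h2

namespace EpsForm

variable {c : E ≃ₐ[F] E} {ε : ℤˣ} {V : Type*} [AddCommGroup V] [Module E V]

theorem form_smul_left (B : EpsForm c ε V) (a : E) (x y : V) :
    B.form (a • x) y = a * B.form x y := by
  simp

theorem form_smul_right (B : EpsForm c ε V) (a : E) (x y : V) :
    B.form x (a • y) = c a * B.form x y := by
  rw [LinearMap.map_smulₛₗ]
  rfl

/-- For an isometry, ⟨(1+g)x, gy⟩ = ⟨x, (1+g)y⟩, so the pairing lemma gives det(1+g) · c(det g) =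
c(det(1+g)). With c trivial, cancelling det(1+g) leaves det g = 1: the nonidentity component never
contributes. -/
theorem mem_identityComponent [FiniteDimensional E V] (B : EpsForm c ε V)
    (hB : B.IsNondegenerate) (g : B.isometryGroup)
    (hg : LinearMap.det (1 + ((g : V ≃ₗ[E] V) : V →ₗ[E] V)) ≠ 0) :
    g ∈ B.identityComponent := by
  rintro ⟨hE, -, -⟩
  have hβ : ∀ x, B.form x = 0 → x = 0 := by
    intro x hx
    by_contra h0
    obtain ⟨y, hy⟩ := hB x h0
    exact hy (by rw [hx]; rfl)
  have h := det_mul_conj_det_of_pairing B.form hβ rfl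
    (1 + ((g : V ≃ₗ[E] V) : V →ₗ[E] V)) ((g : V ≃ₗ[E] V) : V →ₗ[E] V)
    (1 + ((g : V ≃ₗ[E] V) : V →ₗ[E] V)) (fun x y => by
      change B.form (x + (g : V ≃ₗ[E] V) x) ((g : V ≃ₗ[E] V) y) =
        B.form x (y + (g : V ≃ₗ[E] V) y)
      rw [map_add, LinearMap.add_apply, g.2 x y, map_add]
      exact add_comm _ _)
  simp only [RingHom.coe_coe, algEquiv_apply_of_finrank_eq_one hE] at h
  refine Units.ext ?_
  rw [LinearEquiv.coe_det, Units.val_one]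
  exact mul_left_cancel₀ hg (h.trans (mul_one _).symm)

theorem jacobiKernel_eq [FiniteDimensional E V] {C : Type*} [Field C] (B : EpsForm c ε V)
    (hB : B.IsNondegenerate) (χ : Eˣ →* Cˣ) (g : B.isometryGroup) :
    jacobiKernel χ B g =
      MulChar.ofUnitHom χ (LinearMap.det (1 + ((g : V ≃ₗ[E] V) : V →ₗ[E] V))) :=
  jacobiKernel_eq_ofUnitHom χ B g (B.mem_identityComponent hB g)

/-- The parameters `γ` of the transvections `x ↦ x + γ⟨x, w⟩w`. -/
def skewScalars (c : E ≃ₐ[F] E) (ε : ℤˣ) : Submodule F E where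
  carrier := {a | c a + ((ε : ℤ) : E) * a = 0}
  zero_mem' := by simp
  add_mem' := by
    intro a b ha hb
    simp only [Set.mem_ofPred_eq, map_add] at *
    linear_combination ha + hb
  smul_mem' := by
    intro r a ha
    simp only [Set.mem_ofPred_eq, Algebra.smul_def, map_mul, AlgEquiv.commutes] at *
    linear_combination (algebraMap F E r) * ha

theorem mem_skewScalars {a : E} : a ∈ skewScalars c ε ↔ c a + ((ε : ℤ) : E) * a = 0 := Iff.rfl

theorem sign_mul_self (ε : ℤˣ) : ((ε : ℤ) : E) * ((ε : ℤ) : E) = 1 := by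
  rw [← Int.cast_mul, ← Units.val_mul, Int.units_mul_self]
  simp

/-- The Eichler transformation attached to an isotropic vector `w` and to `v ⟂ w`. -/
def eichlerMap (B : EpsForm c ε V) (w v : V) (γ : E) : V →ₗ[E] V where
  toFun x := x + B.form x v • w - (((ε : ℤ) : E) * B.form x w) • v + (γ * B.form x w) • w
  map_add' x y := by
    simp only [map_add, LinearMap.add_apply, mul_add, add_smul]
    abel
  map_smul' a x := by
    simp only [map_smul, LinearMap.smul_apply, smul_eq_mul, RingHom.id_apply]
    module

theorem eichlerMap_apply (B : EpsForm c ε V) (w v : V) (γ : E) (x : V) :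
    B.eichlerMap w v γ x =
      x + B.form x v • w - (((ε : ℤ) : E) * B.form x w) • v + (γ * B.form x w) • w := rfl

/-- A Heisenberg-type law: the vectors add, and the scalars add up to a cocycle. It is what closes
the averaging family under multiplication. -/
theorem eichlerMap_eichlerMap (B : EpsForm c ε V) {w v v' : V} (hw : B.form w w = 0)
    (hv : B.form v w = 0) (hv' : B.form w v' = 0) (γ γ' : E) (x : V) :
    B.eichlerMap w v' γ' (B.eichlerMap w v γ x) =
      B.eichlerMap w (v' + v) (γ' + γ - ((ε : ℤ) : E) * B.form v v') x := by
  simp only [eichlerMap_apply, map_add, map_sub, map_smul, hw, hv, hv']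
  module

/-- The condition on γ is the vanishing of the coefficient of ⟨x,w⟩ · c⟨y,w⟩ in the expansion; the
remaining terms cancel by ε-symmetry. -/
theorem form_eichlerMap (B : EpsForm c ε V) {w v : V}
    (hw : B.form w w = 0) (hv : B.form v w = 0) {γ : E}
    (hγ : c γ + ((ε : ℤ) : E) * γ + B.form v v = 0) (x y : V) :
    B.form (B.eichlerMap w v γ x) (B.eichlerMap w v γ y) = B.form x y := by
  have hv' : B.form w v = 0 := by rw [B.symm v w, hv]; simp
  have e := sign_mul_self (E := E) ε
  have h1 : B.form w y = ((ε : ℤ) : E) * c (B.form y w) := B.symm y w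
  have h2 : B.form v y = ((ε : ℤ) : E) * c (B.form y v) := B.symm y v
  simp only [eichlerMap_apply, map_add, map_sub, form_smul_right, form_smul_left,
    LinearMap.add_apply, LinearMap.sub_apply, hw, hv, hv', h1, h2, map_mul, map_intCast]
  linear_combination (B.form x w * c (B.form y w)) * hγ -
    (B.form x w * c (B.form y v)) * e + (B.form x w * c (B.form y w) * B.form v v) * e

end EpsForm

end

/-! ### The geometry of X and X^⊥, and the determinant for Eichler transformations. -/

section

variable {F : Type*} {E : Type*} [Field F] [Field E] [Algebra F E]
  {c : E ≃ₐ[F] E} {ε : ℤˣ} {V : Type*} [AddCommGroup V] [Module E V]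

namespace EpsForm

theorem form_eq_zero_comm (B : EpsForm c ε V) {x y : V} (h : B.form x y = 0) :
    B.form y x = 0 := by
  rw [B.symm x y, h]; simp

/-- An endomorphism that preserves a nondegenerate form, as an isometry. -/
def isometryOfEnd [FiniteDimensional E V] (B : EpsForm c ε V) (hB : B.IsNondegenerate)
    (f : V →ₗ[E] V) (hf : ∀ x y, B.form (f x) (f y) = B.form x y) : B.isometryGroup :=
  ⟨LinearEquiv.ofInjectiveEndo f (by
    rw [← LinearMap.ker_eq_bot, LinearMap.ker_eq_bot']
    intro x hx
    by_contra h0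
    obtain ⟨y, hy⟩ := hB x h0
    rw [← hf, hx, map_zero] at hy
    exact hy rfl), fun x y => hf x y⟩

theorem isometryOfEnd_apply [FiniteDimensional E V] (B : EpsForm c ε V) (hB : B.IsNondegenerate)
    (f : V →ₗ[E] V) (hf : ∀ x y, B.form (f x) (f y) = B.form x y) (x : V) :
    (B.isometryOfEnd hB f hf : V ≃ₗ[E] V) x = f x := rfl

end EpsForm

namespace Decomposition

variable {B : EpsForm c ε V} (D : Decomposition B)

theorem form_X_sup {x v : V} (hx : x ∈ D.X) (hv : v ∈ D.X ⊔ D.V₀) : B.form x v = 0 := by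
  obtain ⟨x', hx', v', hv', rfl⟩ := Submodule.mem_sup.mp hv
  rw [map_add, D.isotropic_X x hx x' hx', zero_add]
  exact B.form_eq_zero_comm (D.orthogonal_X v' hv' x hx)

theorem form_sup_X {x v : V} (hx : x ∈ D.X) (hv : v ∈ D.X ⊔ D.V₀) : B.form v x = 0 :=
  B.form_eq_zero_comm (D.form_X_sup hx hv)

theorem exists_eq_add_add (u : V) :
    ∃ x ∈ D.X, ∃ v ∈ D.V₀, ∃ y ∈ D.Y, u = x + v + y := by
  have hu : u ∈ D.V₀ ⊔ (D.X ⊔ D.Y) := by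
    rw [D.isCompl.sup_eq_top]
    exact Submodule.mem_top
  obtain ⟨v, hv, z, hz, rfl⟩ := Submodule.mem_sup.mp hu
  obtain ⟨x, hx, y, hy, rfl⟩ := Submodule.mem_sup.mp hz
  exact ⟨x, hx, v, hv, y, hy, by abel⟩

variable {D}

theorem InDuality.eq_zero (hD : D.InDuality) {y : V} (hy : y ∈ D.Y)
    (h : ∀ x ∈ D.X, B.form x y = 0) : y = 0 := by
  have h1 := (hD 0).unique (y₁ := ⟨y, hy⟩) (y₂ := 0) (fun x => (h x x.2).symm)
    (fun x => by simp)
  exact congrArg Subtype.val h1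

theorem InDuality.mem_sup (hD : D.InDuality) {u : V} (h : ∀ x ∈ D.X, B.form x u = 0) :
    u ∈ D.X ⊔ D.V₀ := by
  obtain ⟨x, hx, v, hv, y, hy, rfl⟩ := D.exists_eq_add_add u
  have hxv : x + v ∈ D.X ⊔ D.V₀ := Submodule.add_mem_sup hx hv
  have h0 : y = 0 := hD.eq_zero hy fun x' hx' => by
    have := h x' hx'
    rwa [map_add, D.form_X_sup hx' hxv, zero_add] at this
  rw [h0, add_zero]
  exact hxv

/-- With X ⊕ V₀ = X^⊥, this is X^{⊥⊥} ⊆ X: duality removes the Y-component and nondegeneracy on V₀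
removes the V₀-component. -/
theorem InDuality.mem_X (hD : D.InDuality) (h₀ : D.form₀.IsNondegenerate) {u : V}
    (h : ∀ v ∈ D.X ⊔ D.V₀, B.form v u = 0) : u ∈ D.X := by
  obtain ⟨x, hx, v, hv, rfl⟩ := Submodule.mem_sup.mp
    (hD.mem_sup fun x hx => h x (Submodule.mem_sup_left hx))
  have hv0 : v = 0 := by
    by_contra hne
    obtain ⟨v', hv'⟩ := h₀ ⟨v, hv⟩ (fun h0 => hne (congrArg Subtype.val h0))
    have h1 := h v' (Submodule.mem_sup_right v'.2)
    rw [map_add, D.orthogonal_X v' v'.2 x hx, zero_add] at h1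
    exact hv' (B.form_eq_zero_comm h1)
  rw [hv0, add_zero]
  exact hx

/-- An isometry stabilizing X also stabilizes X^⊥ = X ⊕ V₀, so failure to lie in P is already
visible on X. -/
theorem InDuality.map_X_ne [FiniteDimensional E V] (hD : D.InDuality) {g : B.isometryGroup}
    (hg : g ∉ D.parabolic) : D.X.map ((g : V ≃ₗ[E] V) : V →ₗ[E] V) ≠ D.X := by
  refine fun h => hg ⟨h, Submodule.eq_of_le_of_finrank_eq ?_
    (LinearEquiv.finrank_map_eq (g : V ≃ₗ[E] V) _)⟩
  rintro _ ⟨u, hu, rfl⟩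
  refine hD.mem_sup fun x hx => ?_
  rw [← h] at hx
  obtain ⟨x', hx', rfl⟩ := hx
  exact (g.2 x' u).trans (D.form_X_sup hx' hu)

variable (D)

/-- The parameter `γ` of the Eichler transformation attached to `a` and `v`. -/
def eichlerScalar (B : EpsForm c ε V) (a : E) (v : V) : E :=
  a - ((ε : ℤ) : E) * B.form v v / 2

/-- The term −ε⟨v,v⟩/2 is a particular solution of the isometry condition, and the skew scalars
solve the homogeneous equation. -/
theorem eichlerScalar_spec (h2 : (2 : E) ≠ 0) {a : E} (ha : a ∈ EpsForm.skewScalars c ε) (v : V) :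
    c (eichlerScalar B a v) + ((ε : ℤ) : E) * eichlerScalar B a v + B.form v v = 0 := by
  have e := EpsForm.sign_mul_self (E := E) ε
  have h1 : B.form v v = ((ε : ℤ) : E) * c (B.form v v) := B.symm v v
  have h3 := EpsForm.mem_skewScalars.mp ha
  simp only [eichlerScalar, map_sub, map_div₀, map_mul, map_intCast, map_ofNat]
  field_simp
  linear_combination 2 * h3 + h1 - B.form v v * e

/-- The perturbation has rank at most two, along w and v. Because h is an isometry, ⟨u,w⟩ = −⟨v,y⟩
and ⟨v,v⟩ = ⟨v,u⟩ + ⟨u,v⟩, which turn the 2×2 determinant into a norm minus ⟨y,w⟩ times an affine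
function of a. -/
theorem det_one_add_eichler (h2 : (2 : E) ≠ 0) [FiniteDimensional E V] {h : B.isometryGroup}
    {w v y u : V} (hw : B.form w w = 0) (hv : B.form v w = 0)
    (hy : y + (h : V ≃ₗ[E] V) y = w) (hu : u + (h : V ≃ₗ[E] V) u = v) (a : E) :
    LinearMap.det (1 + B.eichlerMap w v (eichlerScalar B a v) ∘ₗ ((h : V ≃ₗ[E] V) : V →ₗ[E] V)) =
      LinearMap.det (1 + ((h : V ≃ₗ[E] V) : V →ₗ[E] V)) *
        ((1 - ((ε : ℤ) : E) * B.form v y) * c (1 - ((ε : ℤ) : E) * B.form v y) -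
          B.form y w * (a + ((ε : ℤ) : E) * (B.form v u - B.form u v) / 2)) := by
  have e := EpsForm.sign_mul_self (E := E) ε
  set γ := eichlerScalar B a v with hγ
  let f₁ : V →ₗ[E] E := (B.form.flip v + γ • B.form.flip w) ∘ₗ ((h : V ≃ₗ[E] V) : V →ₗ[E] V)
  let f₂ : V →ₗ[E] E := (-((ε : ℤ) : E)) • B.form.flip w ∘ₗ ((h : V ≃ₗ[E] V) : V →ₗ[E] V)
  have hsum : 1 + B.eichlerMap w v γ ∘ₗ ((h : V ≃ₗ[E] V) : V →ₗ[E] V) =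
      (1 + ((h : V ≃ₗ[E] V) : V →ₗ[E] V)) + f₁.smulRight w + f₂.smulRight v := by
    ext x
    change x + B.eichlerMap w v γ ((h : V ≃ₗ[E] V) x) = x + (h : V ≃ₗ[E] V) x +
      (B.form ((h : V ≃ₗ[E] V) x) v + γ * B.form ((h : V ≃ₗ[E] V) x) w) • w +
      (-((ε : ℤ) : E) * B.form ((h : V ≃ₗ[E] V) x) w) • v
    rw [EpsForm.eichlerMap_apply]
    module
  rw [hsum, det_add_smulRight_add_smulRight _ f₁ f₂ hy hu]
  congr 1
  have hhy : (h : V ≃ₗ[E] V) y = w - y := eq_sub_of_add_eq' hy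
  have hhu : (h : V ≃ₗ[E] V) u = v - u := eq_sub_of_add_eq' hu
  have hwv : B.form w v = 0 := B.form_eq_zero_comm hv
  have hf₁y : f₁ y = -B.form y v - γ * B.form y w := by
    change B.form ((h : V ≃ₗ[E] V) y) v + γ * B.form ((h : V ≃ₗ[E] V) y) w = _
    rw [hhy, map_sub, LinearMap.sub_apply, LinearMap.sub_apply, hwv, hw]
    ring
  have hf₁u : f₁ u = B.form v v - B.form u v - γ * B.form u w := by
    change B.form ((h : V ≃ₗ[E] V) u) v + γ * B.form ((h : V ≃ₗ[E] V) u) w = _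
    rw [hhu, map_sub, LinearMap.sub_apply, LinearMap.sub_apply, hv]
    ring
  have hf₂y : f₂ y = ((ε : ℤ) : E) * B.form y w := by
    change (-((ε : ℤ) : E)) * B.form ((h : V ≃ₗ[E] V) y) w = _
    rw [hhy, map_sub, LinearMap.sub_apply, hw]
    ring
  have hf₂u : f₂ u = ((ε : ℤ) : E) * B.form u w := by
    change (-((ε : ℤ) : E)) * B.form ((h : V ≃ₗ[E] V) u) w = _
    rw [hhu, map_sub, LinearMap.sub_apply, hv]
    ring
  -- the isometry relation for `h`, expressed through the preimages under `1 + h`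
  have rel : ∀ p q : V, B.form (p + (h : V ≃ₗ[E] V) p) (q + (h : V ≃ₗ[E] V) q) =
      B.form (p + (h : V ≃ₗ[E] V) p) q + B.form p (q + (h : V ≃ₗ[E] V) q) := by
    intro p q
    have : B.form ((h : V ≃ₗ[E] V) p) ((h : V ≃ₗ[E] V) q) = B.form p q := h.2 p q
    simp only [map_add, LinearMap.add_apply, this]
    ring
  have ruy := rel u y
  have ruu := rel u u
  rw [hu, hy, hv] at ruy
  rw [hu] at ruu
  have s1 : B.form y v = ((ε : ℤ) : E) * c (B.form v y) := B.symm v y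
  have huw : B.form u w = -B.form v y := by linear_combination -ruy
  rw [hf₁y, hf₁u, hf₂y, hf₂u, huw, s1, hγ, eichlerScalar, map_sub, map_mul, map_intCast, map_one]
  field_simp
  linear_combination -(B.form y w * ((ε : ℤ) : E)) * ruu

end Decomposition

end

/-! ### Vanishing off the parabolic subgroup for a nondegenerate form. -/

section

variable {F : Type*} {E : Type*} [Field F] [Field E] [Algebra F E]
  {c : E ≃ₐ[F] E} {ε : ℤˣ} {V : Type*} [AddCommGroup V] [Module E V]

/-- Translation and dilation again; the dilation must be by a c-fixed scalar to preserve the skew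
scalars. Norms t · c(t) are such scalars, which is how χ^{1+c} enters. -/
theorem sum_skewScalars_eq_zero {C : Type*} [Field C]
    [Fintype (EpsForm.skewScalars c ε)] (Φ : E → C) (r : E) (hr : r ≠ 0) (hcr : c r = r)
    (ζ : C) (hζ : ζ ≠ 1) (hΦ : ∀ x, Φ (r * x) = ζ * Φ x) (a₀ : EpsForm.skewScalars c ε) :
    ∑ a : EpsForm.skewScalars c ε, Φ (a - a₀) = 0 := by
  have hmem : ∀ s : E, c s = s → ∀ a ∈ EpsForm.skewScalars c ε,
      s * a ∈ EpsForm.skewScalars c ε := by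
    intro s hs a ha
    rw [EpsForm.mem_skewScalars] at ha ⊢
    rw [map_mul, hs]
    linear_combination s * ha
  let e : EpsForm.skewScalars c ε ≃ EpsForm.skewScalars c ε :=
    { toFun := fun a => ⟨r * a, hmem r hcr a a.2⟩
      invFun := fun a => ⟨r⁻¹ * a, hmem r⁻¹ (by rw [map_inv₀, hcr]) a a.2⟩
      left_inv := fun a => Subtype.ext (inv_mul_cancel_left₀ hr _)
      right_inv := fun a => Subtype.ext (mul_inv_cancel_left₀ hr _) }
  have h1 : ∑ a : EpsForm.skewScalars c ε, Φ (a - a₀) =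
      ∑ a : EpsForm.skewScalars c ε, Φ a :=
    Equiv.sum_comp (Equiv.subRight a₀) (fun a : EpsForm.skewScalars c ε => Φ a)
  have h2 : ∑ a : EpsForm.skewScalars c ε, Φ a = ζ * ∑ a : EpsForm.skewScalars c ε, Φ a := by
    conv_lhs => rw [← Equiv.sum_comp e]
    rw [Finset.mul_sum]
    exact Finset.sum_congr rfl fun a _ => hΦ a
  rw [h1]
  have h3 : (1 - ζ) * ∑ a : EpsForm.skewScalars c ε, Φ a = 0 := by linear_combination h2
  exact (mul_eq_zero.mp h3).resolve_left (sub_ne_zero.mpr hζ.symm)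

namespace Decomposition

variable {B : EpsForm c ε V} (D : Decomposition B)

/-- If ⟨y,w⟩ = 0, the determinant is det(1+h) times the norm of 1 − ε⟨v,y⟩, and the sum over v in
X^⊥ vanishes since y is not in X = X^{⊥⊥}. If ⟨y,w⟩ ≠ 0, the determinant is affine in the skew
scalar a, and the sum over a vanishes for each v. -/
theorem sum_eichler_eq_zero [Finite E] [FiniteDimensional E V] {C : Type*} [Field C]
    (h2 : (2 : E) ≠ 0) (hcc : ∀ x, c (c x) = x)
    (hD : D.InDuality) (h₀ : D.form₀.IsNondegenerate)
    (χ : Eˣ →* Cˣ) (hχ : onePlusConjChar c χ ≠ 1)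
    [Fintype (EpsForm.skewScalars c ε)] [Fintype ↥(D.X ⊔ D.V₀)] (h : B.isometryGroup) {w y : V}
    (hw : w ∈ D.X) (hdet : LinearMap.det (1 + ((h : V ≃ₗ[E] V) : V →ₗ[E] V)) ≠ 0)
    (hyX : y ∉ D.X) (hy : y + (h : V ≃ₗ[E] V) y = w) :
    ∑ i : EpsForm.skewScalars c ε × ↥(D.X ⊔ D.V₀), MulChar.ofUnitHom χ (LinearMap.det
      (1 + B.eichlerMap w i.2 (eichlerScalar B i.1 i.2) ∘ₗ ((h : V ≃ₗ[E] V) : V →ₗ[E] V))) = 0 := by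
  have e := EpsForm.sign_mul_self (E := E) ε
  set d := LinearMap.det (1 + ((h : V ≃ₗ[E] V) : V →ₗ[E] V)) with hd
  have hww : B.form w w = 0 := D.isotropic_X w hw w hw
  choose u hu using fun v : ↥(D.X ⊔ D.V₀) =>
    (LinearMap.equivOfDetNeZero _ hdet).surjective (v : V)
  have hu' : ∀ v, u v + (h : V ≃ₗ[E] V) (u v) = v := hu
  have hform := fun (a : E) (v : ↥(D.X ⊔ D.V₀)) =>
    det_one_add_eichler h2 hww (D.form_sup_X hw v.2) hy (hu' v) a
  simp only [hform]
  obtain ⟨t, ht⟩ := DFunLike.ne_iff.mp hχ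
  have ht' : (onePlusConjChar c χ t : C) ≠ 1 := by simpa using ht
  have hΦ : ∀ x, MulChar.ofUnitHom χ ((t * c t) * x) =
      (onePlusConjChar c χ t : C) * MulChar.ofUnitHom χ x := by
    intro x
    rw [map_mul]
    congr 1
    change MulChar.ofUnitHom χ (((t * Units.map (c : E →* E) t : Eˣ)) : E) = _
    rw [MulChar.ofUnitHom_coe, map_mul]
    rfl
  by_cases hβ : B.form y w = 0
  · rw [Fintype.sum_prod_type]
    refine Finset.sum_eq_zero fun a _ => ?_
    simp only [hβ, zero_mul, sub_zero]
    let l : ↥(D.X ⊔ D.V₀) →ₗ[E] E := (-((ε : ℤ) : E)) • (B.form.flip y ∘ₗ (D.X ⊔ D.V₀).subtype)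
    have hl : ∀ v, 1 + l v = 1 - ((ε : ℤ) : E) * B.form (v : V) y := fun v => by
      change 1 + -((ε : ℤ) : E) * B.form (v : V) y = _
      ring
    have hl0 : l ≠ 0 := by
      intro h0
      refine hyX (hD.mem_X h₀ fun v hv => ?_)
      have h1 : -((ε : ℤ) : E) * B.form v y = 0 :=
        congrArg (fun L : ↥(D.X ⊔ D.V₀) →ₗ[E] E => L ⟨v, hv⟩) h0
      linear_combination (-((ε : ℤ) : E)) * h1 - B.form v y * e
    rw [← sum_one_add_eq_zero l hl0 (fun x => MulChar.ofUnitHom χ (d * (x * c x))) t t.ne_zero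
      (onePlusConjChar c χ t) ht' (fun x => by
        rw [← hΦ, map_mul c]
        congr 1
        ring)]
    exact Finset.sum_congr rfl fun v _ => by rw [hl]
  · rw [Fintype.sum_prod_type_right]
    refine Finset.sum_eq_zero fun v _ => ?_
    dsimp only
    set β := B.form y w with hβdef
    -- Expanding ⟨hy,hy⟩ = ⟨y,y⟩ with hy = w − y gives ⟨y,w⟩ + ⟨w,y⟩ = 0. In the orthogonal case
    -- this forces β = 0, so the present branch is then empty.
    have hcβ : c β = -((ε : ℤ) : E) * β := by
      have r := D.form_X_sup hw (Submodule.mem_sup_left hw)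
      have hh : B.form ((h : V ≃ₗ[E] V) y) ((h : V ≃ₗ[E] V) y) = B.form y y := h.2 y y
      have hhy : (h : V ≃ₗ[E] V) y = w - y := eq_sub_of_add_eq' hy
      rw [hhy] at hh
      simp only [map_sub, LinearMap.sub_apply, hww] at hh
      have s := B.symm y w
      linear_combination (-((ε : ℤ) : E)) * hh - ((ε : ℤ) : E) * s - c β * e
    generalize 1 - ((ε : ℤ) : E) * B.form (v : V) y = N
    obtain ⟨δ, hδ⟩ : ∃ δ, δ = N * c N -
      β * (((ε : ℤ) : E) * (B.form (v : V) (u v) - B.form (u v) v) / 2) := ⟨_, rfl⟩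
    have hcδ : c δ = δ := by
      have s1 := B.symm (v : V) (u v)
      have s2 := B.symm (u v) (v : V)
      have s3 : c (B.form (v : V) (u v)) = ((ε : ℤ) : E) * B.form (u v) v := by
        linear_combination (-((ε : ℤ) : E)) * s1 - c (B.form (v : V) (u v)) * e
      have s4 : c (B.form (u v) v) = ((ε : ℤ) : E) * B.form (v : V) (u v) := by
        linear_combination (-((ε : ℤ) : E)) * s2 - c (B.form (u v) v) * e
      simp only [hδ, map_sub, map_mul, hcc, hcβ, map_div₀, s3, s4, map_intCast, map_ofNat]
      field_simp
      linear_combination -(((ε : ℤ) : E) * β * (B.form (v : V) (u v) - B.form (u v) v)) * e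
    -- The zero of the affine function of a is itself a skew scalar, so translating by it stays
    -- inside the index set.
    have ha₀ : δ / β ∈ EpsForm.skewScalars c ε := by
      rw [EpsForm.mem_skewScalars, map_div₀, hcδ, hcβ]
      have hε : ((ε : ℤ) : E) ≠ 0 := fun h0 => by simp [h0] at e
      field_simp
      linear_combination δ * e
    rw [← sum_skewScalars_eq_zero (fun x => MulChar.ofUnitHom χ (d * (-β * x))) (t * c t)
      (mul_ne_zero t.ne_zero (by simp)) (by rw [map_mul, hcc, mul_comm])
      (onePlusConjChar c χ t) ht' (fun x => by
        rw [← hΦ]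
        congr 1
        ring) ⟨δ / β, ha₀⟩]
    refine Finset.sum_congr rfl fun a _ => ?_
    congr 2
    have hβδ : β * (δ / β) = δ := mul_div_cancel₀ _ hβ
    change _ = -β * (a - δ / β)
    linear_combination -hδ - hβδ

theorem commutator_mem_skewScalars (h2 : (2 : E) ≠ 0) (v v' : V) :
    ((ε : ℤ) : E) * (B.form v' v - B.form v v') / 2 ∈ EpsForm.skewScalars c ε := by
  have e := EpsForm.sign_mul_self (E := E) ε
  rw [EpsForm.mem_skewScalars, map_div₀, map_mul, map_sub, map_intCast, map_ofNat]
  have s1 := B.symm v v'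
  have s2 := B.symm v' v
  field_simp
  linear_combination s1 - s2 + (B.form v' v - B.form v v') * e

/-- The cocycle −ε⟨v,v'⟩ splits into a part absorbed by the quadratic term −ε⟨v+v', v+v'⟩/2 and an
antisymmetric part, which shifts the skew scalar. -/
theorem eichlerScalar_add_add (h2 : (2 : E) ≠ 0) (a a' : E) (v v' : V) :
    eichlerScalar B a' v' + eichlerScalar B a v - ((ε : ℤ) : E) * B.form v v' =
      eichlerScalar B (a' + a + ((ε : ℤ) : E) * (B.form v' v - B.form v v') / 2) (v' + v) := by
  simp only [eichlerScalar, map_add, LinearMap.add_apply]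
  field_simp
  ring

/-- The family is indexed by skew scalars and vectors of X^⊥. The parametrization need not be
injective: the averaging only asks that left multiplication by a member permute the indices. -/
theorem finsum_jacobiKernel_eq_zero [Finite F] [Finite E] [FiniteDimensional E V]
    {C : Type*} [Field C] (hC : (Nat.card F : C) ≠ 0)
    (h2 : (2 : E) ≠ 0) (hcc : ∀ x, c (c x) = x) (hB : B.IsNondegenerate)
    (hD : D.InDuality) (h₀ : D.form₀.IsNondegenerate)
    (χ : Eˣ →* Cˣ) (hχ : onePlusConjChar c χ ≠ 1) (g : B.isometryGroup) (hg : g ∉ D.parabolic) :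
    ∑ᶠ n : (D.leviX.prod D.leviV₀).ker,
      jacobiKernel χ B (g * ((n : D.parabolic) : B.isometryGroup)) = 0 := by
  have hfinV : Finite V := Module.finite_of_finite E
  have := Fintype.ofFinite (D.leviX.prod D.leviV₀).ker
  have := Fintype.ofFinite (EpsForm.skewScalars c ε)
  have := Fintype.ofFinite ↥(D.X ⊔ D.V₀)
  obtain ⟨w, hw, hwg⟩ := D.exists_mem_X_notMem_map g (hD.map_X_ne hg)
  have hww : B.form w w = 0 := D.isotropic_X w hw w hw
  let T : EpsForm.skewScalars c ε × ↥(D.X ⊔ D.V₀) → B.isometryGroup := fun i =>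
    B.isometryOfEnd hB (B.eichlerMap w i.2 (eichlerScalar B i.1 i.2))
      (B.form_eichlerMap hww (D.form_sup_X hw i.2.2) (eichlerScalar_spec h2 i.1.2 (i.2 : V)))
  have hT : ∀ i v, (T i : V ≃ₗ[E] V) v = B.eichlerMap w i.2 (eichlerScalar B i.1 i.2) v :=
    fun i v => rfl
  let k : EpsForm.skewScalars c ε × ↥(D.X ⊔ D.V₀) → (D.leviX.prod D.leviV₀).ker := fun i =>
    D.unipotentMk (T i)
      (fun x hx => by
        rw [hT, EpsForm.eichlerMap_apply, D.form_X_sup hx i.2.2, D.isotropic_X x hx w hw]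
        simp)
      (fun v hv => by
        rw [hT, EpsForm.eichlerMap_apply, D.orthogonal_X v hv w hw]
        simpa using D.X.smul_mem _ hw)
  rw [finsum_eq_sum_of_fintype]
  refine sum_mul_left_coset_eq_zero
    (D.parabolic.subtype.comp (D.leviX.prod D.leviV₀).ker.subtype) (jacobiKernel χ B)
    (jacobiKernel_conj χ B) k (fun i₀ => ?_) ?_ g (fun n hn => ?_)
  · let f : EpsForm.skewScalars c ε × ↥(D.X ⊔ D.V₀) → EpsForm.skewScalars c ε × ↥(D.X ⊔ D.V₀) :=
      fun i => (i₀.1 + i.1 + ⟨_, commutator_mem_skewScalars (B := B) h2 (i.2 : V) i₀.2⟩, i₀.2 + i.2)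
    have hf : Function.Injective f := by
      rintro ⟨a, v⟩ ⟨a', v'⟩ h
      have h1 : v = v' := add_left_cancel (congrArg Prod.snd h)
      subst h1
      exact Prod.ext (add_left_cancel (add_right_cancel (congrArg Prod.fst h))) rfl
    refine ⟨Equiv.ofBijective f (Finite.injective_iff_bijective.mp hf), fun i => ?_⟩
    refine Subtype.ext (Subtype.ext (Subtype.ext (LinearEquiv.ext fun v => ?_)))
    change (T i₀ : V ≃ₗ[E] V) ((T i : V ≃ₗ[E] V) v) = (T (f i) : V ≃ₗ[E] V) v
    rw [hT, hT, hT, B.eichlerMap_eichlerMap hww (D.form_sup_X hw i.2.2)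
      (D.form_X_sup hw i₀.2.2), eichlerScalar_add_add h2]
    rfl
  · rw [Fintype.card_prod, Nat.cast_mul, ← Nat.card_eq_fintype_card, ← Nat.card_eq_fintype_card]
    let := Module.compHom ↥(D.X ⊔ D.V₀) (algebraMap F E)
    exact mul_ne_zero (natCast_card_ne_zero hC) (natCast_card_ne_zero hC)
  · set h : B.isometryGroup := g * ((n : D.parabolic) : B.isometryGroup) with hh
    change jacobiKernel χ B h ≠ 0 at hn
    change ∑ i, jacobiKernel χ B (T i * h) = 0
    have hdet : LinearMap.det (1 + ((h : V ≃ₗ[E] V) : V →ₗ[E] V)) ≠ 0 := by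
      rintro h0
      rw [B.jacobiKernel_eq hB, h0] at hn
      exact hn (MulChar.map_nonunit _ not_isUnit_zero)
    obtain ⟨y, hyX, hy⟩ := D.exists_notMem_X_add_apply_eq hwg n hdet
    rw [← D.sum_eichler_eq_zero h2 hcc hD h₀ χ hχ h hw hdet hyX hy]
    refine Finset.sum_congr rfl fun i _ => ?_
    rw [B.jacobiKernel_eq hB]
    rfl

end Decomposition

end

/-! ### Factorization of the kernel on the parabolic subgroup. -/

section

theorem det_prod_of_triangular {E M N : Type*} [Field E] [AddCommGroup M] [Module E M]
    [FiniteDimensional E M] [AddCommGroup N] [Module E N] [FiniteDimensional E N]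
    (f : M × N →ₗ[E] M × N) (f₁ : M →ₗ[E] M) (f₂ : N →ₗ[E] N)
    (h₁ : ∀ m, f (m, 0) = (f₁ m, 0)) (h₂ : ∀ n, (f (0, n)).2 = f₂ n) :
    LinearMap.det f = LinearMap.det f₁ * LinearMap.det f₂ := by
  classical
  let bM := Module.finBasis E M
  let bN := Module.finBasis E N
  let b := bM.prod bN
  have hmat : LinearMap.toMatrix b b f = Matrix.fromBlocks (LinearMap.toMatrix bM bM f₁)
      (Matrix.of fun i j => bM.repr (f (0, bN j)).1 i) 0 (LinearMap.toMatrix bN bN f₂) := by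
    ext i j
    rcases i with i | i <;> rcases j with j | j <;>
      simp [b, LinearMap.toMatrix_apply, h₁, h₂]
  rw [← LinearMap.det_toMatrix b, hmat, Matrix.det_fromBlocks_zero₂₁, LinearMap.det_toMatrix,
    LinearMap.det_toMatrix]

theorem det_of_triangular {E M₁ M₂ M₃ V : Type*} [Field E] [AddCommGroup M₁] [Module E M₁]
    [FiniteDimensional E M₁] [AddCommGroup M₂] [Module E M₂] [FiniteDimensional E M₂]
    [AddCommGroup M₃] [Module E M₃] [FiniteDimensional E M₃] [AddCommGroup V] [Module E V]
    (e : (M₁ × M₂ × M₃) ≃ₗ[E] V) (f : V →ₗ[E] V) (f₁ : M₁ →ₗ[E] M₁) (f₂ : M₂ →ₗ[E] M₂)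
    (f₃ : M₃ →ₗ[E] M₃) (h₁ : ∀ m, f (e (m, 0, 0)) = e (f₁ m, 0, 0))
    (h₂ : ∀ m, (e.symm (f (e (0, m, 0)))).2 = (f₂ m, 0))
    (h₃ : ∀ m, (e.symm (f (e (0, 0, m)))).2.2 = f₃ m) :
    LinearMap.det f = LinearMap.det f₁ * (LinearMap.det f₂ * LinearMap.det f₃) := by
  let f' : M₂ × M₃ →ₗ[E] M₂ × M₃ :=
    LinearMap.snd E M₁ (M₂ × M₃) ∘ₗ (e.symm.toLinearMap ∘ₗ f ∘ₗ e.toLinearMap) ∘ₗ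
      LinearMap.inr E M₁ (M₂ × M₃)
  rw [← det_prod_of_triangular f' f₂ f₃ h₂ h₃, ← LinearMap.det_conj f e.symm]
  refine det_prod_of_triangular _ f₁ f' (fun m => ?_) (fun n => rfl)
  change e.symm (f (e (m, 0, 0))) = _
  rw [h₁, e.symm_apply_apply]
  rfl

namespace Decomposition

variable {F : Type*} {E : Type*} [Field F] [Field E] [Algebra F E]
  {c : E ≃ₐ[F] E} {ε : ℤˣ} {V : Type*} [AddCommGroup V] [Module E V]
  {B : EpsForm c ε V} (D : Decomposition B)

/-- The isomorphism `X × V₀ × Y ≃ V`. -/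
def sumEquiv : (D.X × D.V₀ × D.Y) ≃ₗ[E] V :=
  LinearEquiv.ofBijective
    (D.X.subtype.coprod (D.V₀.subtype.coprod D.Y.subtype)) (by
      constructor
      · rw [← LinearMap.ker_eq_bot, LinearMap.ker_eq_bot']
        rintro ⟨x, v, y⟩ h
        have h' : (x : V) + ((v : V) + (y : V)) = 0 := h
        have hv : (v : V) = 0 := by
          refine Submodule.disjoint_def.mp D.isCompl.disjoint v v.2 ?_
          have : (v : V) = -((x : V) + y) := by rw [← sub_eq_zero, ← h']; abel
          rw [this]
          exact Submodule.neg_mem _ (Submodule.add_mem_sup x.2 y.2)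
        rw [hv, zero_add] at h'
        have hx : (x : V) = 0 := by
          refine Submodule.disjoint_def.mp D.disjoint x x.2 ?_
          rw [eq_neg_of_add_eq_zero_left h']
          exact D.Y.neg_mem y.2
        rw [hx, zero_add] at h'
        exact Prod.ext (Subtype.ext hx) (Prod.ext (Subtype.ext hv) (Subtype.ext h'))
      · intro u
        obtain ⟨x, hx, v, hv, y, hy, rfl⟩ := D.exists_eq_add_add u
        exact ⟨(⟨x, hx⟩, ⟨v, hv⟩, ⟨y, hy⟩), (add_assoc _ _ _).symm⟩)

theorem sumEquiv_apply (x : D.X) (v : D.V₀) (y : D.Y) :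
    D.sumEquiv (x, v, y) = (x : V) + ((v : V) + (y : V)) := rfl

theorem sumEquiv_symm_X (x : D.X) : D.sumEquiv.symm (x : V) = (x, 0, 0) := by
  rw [LinearEquiv.symm_apply_eq]; simp [sumEquiv_apply]

theorem sumEquiv_symm_V₀ (v : D.V₀) : D.sumEquiv.symm (v : V) = (0, v, 0) := by
  rw [LinearEquiv.symm_apply_eq]; simp [sumEquiv_apply]

theorem sumEquiv_symm_Y (y : D.Y) : D.sumEquiv.symm (y : V) = (0, 0, y) := by
  rw [LinearEquiv.symm_apply_eq]; simp [sumEquiv_apply]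

/-- The action of the parabolic subgroup on `V / (X ⊕ V₀)`, identified with `Y`. -/
def actY (p : D.parabolic) : D.Y →ₗ[E] D.Y :=
  LinearMap.snd E D.V₀ D.Y ∘ₗ LinearMap.snd E D.X (D.V₀ × D.Y) ∘ₗ
    D.sumEquiv.symm.toLinearMap ∘ₗ (((p : B.isometryGroup) : V ≃ₗ[E] V) : V →ₗ[E] V) ∘ₗ
    D.Y.subtype

theorem det_one_add_parabolic [FiniteDimensional E V] (p : D.parabolic) :
    LinearMap.det (1 + (((p : B.isometryGroup) : V ≃ₗ[E] V) : V →ₗ[E] V)) =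
      LinearMap.det (1 + (D.leviX p : D.X →ₗ[E] D.X)) *
      (LinearMap.det (1 + ((D.leviV₀ p : D.V₀ ≃ₗ[E] D.V₀) : D.V₀ →ₗ[E] D.V₀)) *
        LinearMap.det (1 + D.actY p)) := by
  refine det_of_triangular D.sumEquiv _ _ _ _ (fun x => ?_) (fun v => ?_) (fun y => ?_)
  · change D.sumEquiv (x, 0, 0) + ((p : B.isometryGroup) : V ≃ₗ[E] V) (D.sumEquiv (x, 0, 0)) =
      D.sumEquiv (x + D.leviX p x, 0, 0)
    simp [sumEquiv_apply, leviX_apply]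
  · change (D.sumEquiv.symm (D.sumEquiv (0, v, 0) +
      ((p : B.isometryGroup) : V ≃ₗ[E] V) (D.sumEquiv (0, v, 0)))).2 =
      (v + (D.leviV₀ p : D.V₀ ≃ₗ[E] D.V₀) v, 0)
    have h0 : D.sumEquiv (0, v, 0) = v := by simp [sumEquiv_apply]
    obtain ⟨x, hx, h⟩ := D.exists_eq_add
      (D.map_mem_sup p (Submodule.mem_sup_right v.2 : (v : V) ∈ D.X ⊔ D.V₀))
    rw [leviV₀_apply, h0, h, map_add, map_add, sumEquiv_symm_V₀, sumEquiv_symm_V₀,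
      D.sumEquiv_symm_X ⟨x, hx⟩, ← h]
    simp
  · change (D.sumEquiv.symm (D.sumEquiv (0, 0, y) +
      ((p : B.isometryGroup) : V ≃ₗ[E] V) (D.sumEquiv (0, 0, y)))).2.2 = y + D.actY p y
    have h0 : D.sumEquiv (0, 0, y) = y := by simp [sumEquiv_apply]
    rw [h0, map_add, sumEquiv_symm_Y]
    rfl

/-- Passing from p y to its Y-component changes it by an element of X ⊕ V₀, which is orthogonal to
X. Thus the action on Y is contragredient to the action on X. -/
theorem form_map_actY (p : D.parabolic) (x : D.X) (y : D.Y) :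
    B.form (((p : B.isometryGroup) : V ≃ₗ[E] V) x) (D.actY p y : V) = B.form (x : V) (y : V) := by
  rw [← (p : B.isometryGroup).2 (x : V) (y : V)]
  obtain ⟨⟨x', v', y'⟩, h⟩ := D.sumEquiv.surjective (((p : B.isometryGroup) : V ≃ₗ[E] V) y)
  have h1 : D.actY p y = y' := by
    change (D.sumEquiv.symm (((p : B.isometryGroup) : V ≃ₗ[E] V) y)).2.2 = y'
    rw [← h, LinearEquiv.symm_apply_apply]
  rw [h1, ← h, sumEquiv_apply, ← add_assoc, map_add,
    D.form_X_sup (D.map_mem_X p x.2) (Submodule.add_mem_sup x'.2 v'.2), zero_add]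

variable {D}

theorem eq_zero_of_form_X_Y (hB : B.IsNondegenerate) {x : V} (hx : x ∈ D.X)
    (h : ∀ y ∈ D.Y, B.form x y = 0) : x = 0 := by
  by_contra h0
  obtain ⟨u, hu⟩ := hB x h0
  obtain ⟨x', hx', v, hv, y, hy, rfl⟩ := D.exists_eq_add_add u
  rw [map_add, D.form_X_sup hx (Submodule.add_mem_sup hx' hv), h y hy, zero_add] at hu
  exact hu rfl

/-- The functional `x ↦ ⟨x, y⟩` on `X`. -/
def dualityMap (D : Decomposition B) (y : D.Y) : Module.Dual E D.X :=
  B.form.flip (y : V) ∘ₗ D.X.subtype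

theorem InDuality.dualityMap_bijective (hD : D.InDuality) : Function.Bijective D.dualityMap := by
  refine Function.bijective_iff_existsUnique _ |>.mpr fun l => ?_
  refine (hD l).imp fun y hy => ⟨?_, fun y' hy' => hy.2 y' fun x => ?_⟩
  · exact LinearMap.ext fun x => (hy.1 x).symm
  · rw [← hy']
    rfl

/-- The bijection from Y to the dual of X is only c-semilinear, so dimensions are compared through
cardinalities. -/
theorem InDuality.finrank_eq [Finite E] [FiniteDimensional E V] (hD : D.InDuality) :
    Module.finrank E D.X = Module.finrank E D.Y := by
  have h := Nat.card_eq_of_bijective _ hD.dualityMap_bijective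
  rw [Module.natCard_eq_pow_finrank (K := E) (V := D.Y),
    Module.natCard_eq_pow_finrank (K := E) (V := Module.Dual E D.X),
    Subspace.dual_finrank_eq] at h
  exact (Nat.pow_right_injective Finite.one_lt_card h).symm

theorem det_pairing_X_Y [Finite E] [FiniteDimensional E V] (hB : B.IsNondegenerate)
    (hD : D.InDuality) (f : D.X →ₗ[E] D.X) (g₁ g₂ : D.Y →ₗ[E] D.Y)
    (h : ∀ x y, B.form (f x : V) (g₁ y : V) = B.form (x : V) (g₂ y : V)) :
    LinearMap.det f * c (LinearMap.det g₁) = c (LinearMap.det g₂) :=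
  det_mul_conj_det_of_pairing (B.form.domRestrict₁₂ D.X D.Y)
    (fun x hx => Subtype.ext (eq_zero_of_form_X_Y hB x.2 fun y hy =>
      congrArg (fun L : D.Y →ₛₗ[(c : E →+* E)] E => L ⟨y, hy⟩) hx))
    hD.finrank_eq f g₁ g₂ h

/-- The determinant on Y is eliminated by the pairing lemma applied to p and to 1+p, giving
det(1+p_Y) = c(det(1+a)) · c(det a)⁻¹. The first factor completes χ to χ^{1+c}; the second is the
twist. -/
theorem jacobiKernel_parabolic [Finite E] [FiniteDimensional E V] {C : Type*} [Field C]
    (hcc : ∀ x, c (c x) = x) (hB : B.IsNondegenerate)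
    (hD : D.InDuality) (h₀ : D.form₀.IsNondegenerate) (χ : Eˣ →* Cˣ) (p : D.parabolic) :
    jacobiKernel χ B p =
      MulChar.ofUnitHom (onePlusConjChar c χ)
          (LinearMap.det (1 + (D.leviX p : D.X →ₗ[E] D.X))) *
        ((conjChar c χ)⁻¹ (LinearEquiv.det (D.leviX p)) : C) *
        jacobiKernel χ D.form₀ (D.leviV₀ p) := by
  have h1 : LinearMap.det (1 + (D.leviX p : D.X →ₗ[E] D.X)) * c (LinearMap.det (D.actY p)) =
      c (LinearMap.det (1 + D.actY p)) :=
    det_pairing_X_Y hB hD _ _ _ fun x y => by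
      change B.form ((x : V) + ((p : B.isometryGroup) : V ≃ₗ[E] V) x) (D.actY p y : V) =
        B.form (x : V) ((y : V) + (D.actY p y : V))
      rw [map_add, LinearMap.add_apply, D.form_map_actY, map_add, add_comm]
  have h2 : LinearMap.det (D.leviX p : D.X →ₗ[E] D.X) * c (LinearMap.det (D.actY p)) = 1 := by
    refine (det_pairing_X_Y hB hD (D.leviX p : D.X →ₗ[E] D.X) (D.actY p) 1
      (D.form_map_actY p)).trans ?_
    rw [map_one, map_one]
  set a := LinearEquiv.det (D.leviX p) with ha
  have h2' : LinearMap.det (D.actY p) = (((Units.map (c : E →* E) a)⁻¹ : Eˣ) : E) := by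
    have h3 := congrArg c h2
    rw [map_mul, hcc, map_one] at h3
    have h4 : ((Units.map (c : E →* E) a : Eˣ) : E) * LinearMap.det (D.actY p) = 1 := by
      change c ((a : Eˣ) : E) * _ = 1
      rw [ha, LinearEquiv.coe_det]
      exact h3
    exact (eq_comm.mp (Units.inv_eq_of_mul_eq_one_right h4))
  have h5 : LinearMap.det (1 + D.actY p) =
      c (LinearMap.det (1 + (D.leviX p : D.X →ₗ[E] D.X))) *
        (((Units.map (c : E →* E) a)⁻¹ : Eˣ) : E) := by
    rw [← h2', ← hcc (LinearMap.det (1 + D.actY p)), ← h1, map_mul, hcc]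
  have hnorm : ∀ x : E, MulChar.ofUnitHom (onePlusConjChar c χ) x =
      MulChar.ofUnitHom χ x * MulChar.ofUnitHom χ (c x) := by
    intro x
    by_cases hx : x = 0
    · rw [hx, map_zero c, MulChar.map_nonunit _ not_isUnit_zero,
        MulChar.map_nonunit _ not_isUnit_zero, zero_mul]
    · lift x to Eˣ using (isUnit_iff_ne_zero.mpr hx)
      have : c (x : E) = (Units.map (c : E →* E) x : Eˣ) := rfl
      rw [this, MulChar.ofUnitHom_coe, MulChar.ofUnitHom_coe, MulChar.ofUnitHom_coe]
      rfl
  have hψ : (((conjChar c χ)⁻¹ a : Cˣ) : C) =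
      MulChar.ofUnitHom χ (((Units.map (c : E →* E) a)⁻¹ : Eˣ) : E) := by
    rw [MulChar.ofUnitHom_coe, map_inv]
    rfl
  rw [B.jacobiKernel_eq hB, D.form₀.jacobiKernel_eq h₀, det_one_add_parabolic, h5, hnorm, hψ]
  simp only [map_mul]
  ring

theorem jacobiKernel_parabolic_of_form_eq_zero [FiniteDimensional E V] {C : Type*} [Field C]
    (hB : B.form = 0) (hY : D.Y = ⊥) (χ : Eˣ →* Cˣ) (p : D.parabolic) :
    jacobiKernel χ B p =
      MulChar.ofUnitHom χ (LinearMap.det (1 + (D.leviX p : D.X →ₗ[E] D.X))) *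
        (((1 : Eˣ →* Cˣ) (LinearEquiv.det (D.leviX p)) : Cˣ) : C) *
        jacobiKernel χ D.form₀ (D.leviV₀ p) := by
  have hB₀ : D.form₀.form = 0 := by
    ext v w
    change B.form (v : V) (w : V) = 0
    rw [hB]
    rfl
  have : Subsingleton D.Y := by rw [hY]; infer_instance
  rw [jacobiKernel_eq_ofUnitHom χ B p fun _ => mem_identityComponent_of_form_eq_zero B hB p,
    jacobiKernel_eq_ofUnitHom χ D.form₀ (D.leviV₀ p)
      fun _ => mem_identityComponent_of_form_eq_zero D.form₀ hB₀ _,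
    det_one_add_parabolic, LinearMap.det_eq_one_of_subsingleton (1 + D.actY p), mul_one, map_mul,
    MonoidHom.one_apply, Units.val_one, mul_one]

/-! ### Surjectivity of the projection to the Levi part -/

theorem levi_surjective [FiniteDimensional E V]
    (h : ∀ (a : D.X ≃ₗ[E] D.X) (b : D.form₀.isometryGroup), ∃ g : B.isometryGroup,
      (∀ x : D.X, (g : V ≃ₗ[E] V) x = a x) ∧
      ∀ v : D.V₀, (g : V ≃ₗ[E] V) v = ((b : D.V₀ ≃ₗ[E] D.V₀) v : V)) :
    Function.Surjective (D.leviX.prod D.leviV₀) := by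
  rintro ⟨a, b⟩
  obtain ⟨g, hX, hV₀⟩ := h a b
  have h1 : D.X.map ((g : V ≃ₗ[E] V) : V →ₗ[E] V) ≤ D.X := by
    rintro _ ⟨x, hx, rfl⟩
    exact (hX ⟨x, hx⟩).symm ▸ (a ⟨x, hx⟩).2
  have h2 : (D.X ⊔ D.V₀).map ((g : V ≃ₗ[E] V) : V →ₗ[E] V) ≤ D.X ⊔ D.V₀ := by
    rw [Submodule.map_sup]
    refine sup_le_sup h1 ?_
    rintro _ ⟨v, hv, rfl⟩
    exact (hV₀ ⟨v, hv⟩).symm ▸ ((b : D.V₀ ≃ₗ[E] D.V₀) ⟨v, hv⟩).2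
  refine ⟨⟨g, Submodule.eq_of_le_of_finrank_eq h1 (LinearEquiv.finrank_map_eq (g : V ≃ₗ[E] V) _),
    Submodule.eq_of_le_of_finrank_eq h2 (LinearEquiv.finrank_map_eq (g : V ≃ₗ[E] V) _)⟩, ?_⟩
  refine Prod.ext (LinearEquiv.ext fun x => Subtype.ext (hX x))
    (Subtype.ext (LinearEquiv.ext fun v => ?_))
  change D.proj₀ ((g : V ≃ₗ[E] V) v) = _
  rw [hV₀, D.proj₀_V₀]

theorem levi_surjective_of_form_eq_zero [FiniteDimensional E V] (hB : B.form = 0) :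
    Function.Surjective (D.leviX.prod D.leviV₀) := by
  refine levi_surjective fun a b => ⟨⟨D.sumEquiv.symm.trans
    ((a.prodCongr ((b : D.V₀ ≃ₗ[E] D.V₀).prodCongr (LinearEquiv.refl E D.Y))).trans D.sumEquiv),
    fun x y => by simp [hB]⟩, fun x => ?_, fun v => ?_⟩
  · simp [sumEquiv_symm_X, sumEquiv_apply]
  · simp [sumEquiv_symm_V₀, sumEquiv_apply]

theorem InDuality.exists_contragredient (hD : D.InDuality) (a : D.X ≃ₗ[E] D.X) :
    ∃ a' : D.Y →ₗ[E] D.Y, ∀ x y, B.form (a x : V) (a' y : V) = B.form (x : V) (y : V) := by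
  choose f hf using fun y : D.Y => hD.dualityMap_bijective.2
    (D.dualityMap y ∘ₗ (a.symm : D.X →ₗ[E] D.X))
  have hf' : ∀ (y : D.Y) (x : D.X), B.form (x : V) (f y : V) = B.form (a.symm x : V) (y : V) :=
    fun y x => congrArg (fun L : Module.Dual E D.X => L x) (hf y)
  refine ⟨{ toFun := f, map_add' := fun y y' => ?_, map_smul' := fun r y => ?_ }, fun x y => ?_⟩
  · refine hD.dualityMap_bijective.1 (LinearMap.ext fun x => ?_)
    change B.form (x : V) (f (y + y') : V) = B.form (x : V) ((f y : V) + (f y' : V))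
    rw [hf', map_add, hf', hf', Submodule.coe_add, map_add]
  · refine hD.dualityMap_bijective.1 (LinearMap.ext fun x => ?_)
    change B.form (x : V) (f (r • y) : V) = B.form (x : V) (r • (f y : V))
    rw [hf', EpsForm.form_smul_right, hf', Submodule.coe_smul, EpsForm.form_smul_right]
  · change B.form (a x : V) (f y : V) = _
    rw [hf', LinearEquiv.symm_apply_apply]

theorem form_sumEquiv (D : Decomposition B) (x x' : D.X) (v v' : D.V₀) (y y' : D.Y) :
    B.form (D.sumEquiv (x, v, y)) (D.sumEquiv (x', v', y')) =
      B.form (x : V) (y' : V) + B.form (v : V) (v' : V) +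
        ((ε : ℤ) : E) * c (B.form (x' : V) (y : V)) := by
  have h1 := D.form_X_sup x.2 (Submodule.add_mem_sup x'.2 v'.2)
  have h2 : B.form (v : V) (x' : V) = 0 := D.orthogonal_X v v.2 x' x'.2
  have h3 : B.form (v : V) (y' : V) = 0 := D.orthogonal_Y v v.2 y' y'.2
  have h4 : B.form (y : V) (v' : V) = 0 :=
    B.form_eq_zero_comm (D.orthogonal_Y v' v'.2 y y.2)
  have h5 := D.isotropic_Y y y.2 y' y'.2
  have h6 := B.symm (x' : V) (y : V)
  rw [map_add] at h1
  simp only [sumEquiv_apply, map_add, LinearMap.add_apply, h2, h3, h4, h5, h6]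
  linear_combination h1

/-- The lift is block diagonal with the contragredient on Y. Preserving a nondegenerate form makes
it invertible automatically. -/
theorem InDuality.levi_surjective [FiniteDimensional E V] (hB : B.IsNondegenerate)
    (hD : D.InDuality) : Function.Surjective (D.leviX.prod D.leviV₀) := by
  refine Decomposition.levi_surjective fun a b => ?_
  obtain ⟨a', ha'⟩ := hD.exists_contragredient a
  let f : V →ₗ[E] V := D.sumEquiv.toLinearMap ∘ₗ
    ((a : D.X →ₗ[E] D.X).prodMap (((b : D.V₀ ≃ₗ[E] D.V₀) : D.V₀ →ₗ[E] D.V₀).prodMap a')) ∘ₗ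
    D.sumEquiv.symm.toLinearMap
  have hf : ∀ x v y, f (D.sumEquiv (x, v, y)) =
      D.sumEquiv (a x, (b : D.V₀ ≃ₗ[E] D.V₀) v, a' y) := fun x v y => by
    simp [f]
  refine ⟨B.isometryOfEnd hB f fun u u' => ?_, fun x => ?_, fun v => ?_⟩
  · obtain ⟨⟨x, v, y⟩, rfl⟩ := D.sumEquiv.surjective u
    obtain ⟨⟨x', v', y'⟩, rfl⟩ := D.sumEquiv.surjective u'
    have hb : B.form ((b : D.V₀ ≃ₗ[E] D.V₀) v : V) ((b : D.V₀ ≃ₗ[E] D.V₀) v' : V) =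
      B.form (v : V) (v' : V) := b.2 v v'
    rw [hf, hf, form_sumEquiv, form_sumEquiv, ha', ha', hb]
  · rw [EpsForm.isometryOfEnd_apply]
    have : (x : V) = D.sumEquiv (x, 0, 0) := by simp [sumEquiv_apply]
    rw [this, hf]
    simp [sumEquiv_apply]
  · rw [EpsForm.isometryOfEnd_apply]
    have : (v : V) = D.sumEquiv (0, v, 0) := by simp [sumEquiv_apply]
    rw [this, hf]
    simp [sumEquiv_apply]

end Decomposition

end

section

/-! ### Skew forms and the order of the Lie algebra -/

variable {F : Type*} {E : Type*} [Field F] [Field E] [Algebra F E]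

theorem natCard_linearMap {M N : Type*} [AddCommGroup M] [Module E M] [FiniteDimensional E M]
    [AddCommGroup N] [Module E N] [FiniteDimensional E N] :
    Nat.card (M →ₗ[E] N) = Nat.card E ^ (Module.finrank E M * Module.finrank E N) := by
  rw [Module.natCard_eq_pow_finrank (K := E), Module.finrank_linearMap]

section SkewForms

variable (c : E ≃ₐ[F] E) (ε : ℤˣ)
variable (W W₁ W₂ : Type*) [AddCommGroup W] [Module E W] [AddCommGroup W₁] [Module E W₁]
  [AddCommGroup W₂] [Module E W₂]

/-- Composition with `c` identifies `c`-semilinear and linear functionals. -/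
def semilinearFunctionalEquiv : (W →ₛₗ[(c : E →+* E)] E) ≃ (W →ₗ[E] E) where
  toFun f :=
    { toFun := fun x => c.symm (f x)
      map_add' := fun x y => by rw [map_add, map_add]
      map_smul' := fun r x => by
        rw [LinearMap.map_smulₛₗ, smul_eq_mul, map_mul]
        change c.symm (c r) * _ = _
        rw [c.symm_apply_apply]
        rfl }
  invFun f :=
    { toFun := fun x => c (f x)
      map_add' := fun x y => by rw [map_add, map_add]
      map_smul' := fun r x => by
        rw [map_smul, smul_eq_mul, map_mul]
        rfl }
  left_inv f := LinearMap.ext fun x => c.apply_symm_apply (f x)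
  right_inv f := LinearMap.ext fun x => c.symm_apply_apply (f x)

/-- The semilinear functionals are equinumerous with the dual, hence have the same dimension over
the finite field E. -/
theorem natCard_sesqForm [Finite E] [FiniteDimensional E W₁] [FiniteDimensional E W₂] :
    Nat.card (W₁ →ₗ[E] W₂ →ₛₗ[(c : E →+* E)] E) =
      Nat.card E ^ (Module.finrank E W₁ * Module.finrank E W₂) := by
  have : Finite (W₂ →ₗ[E] E) := Module.finite_of_finite E
  have : Finite (W₂ →ₛₗ[(c : E →+* E)] E) := Finite.of_equiv _ (semilinearFunctionalEquiv c W₂).symm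
  have : Module.Finite E (W₂ →ₛₗ[(c : E →+* E)] E) := Module.Finite.of_finite
  have h := Nat.card_congr (semilinearFunctionalEquiv c W₂)
  rw [Module.natCard_eq_pow_finrank (K := E) (V := W₂ →ₛₗ[(c : E →+* E)] E),
    natCard_linearMap, Module.finrank_self, mul_one] at h
  rw [natCard_linearMap, Nat.pow_right_injective Finite.one_lt_card h]

/-- The `(-ε)`-sesquilinear forms on `W`. -/
def skewForms : Submodule F (W →ₗ[E] W →ₛₗ[(c : E →+* E)] E) where
  carrier := {β | ∀ x y, β y x = -(((ε : ℤ) : E) * c (β x y))}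
  zero_mem' := by intro x y; simp
  add_mem' := by
    intro β β' h h' x y
    simp only [LinearMap.add_apply, h x y, h' x y, map_add]
    ring
  smul_mem' := by
    intro r β h x y
    simp only [LinearMap.smul_apply, h x y, Algebra.smul_def, map_mul, AlgEquiv.commutes]
    ring

variable {c ε W W₁ W₂}

/-- The conjugate transpose of a sesquilinear form. -/
def conjTranspose (hcc : ∀ x, c (c x) = x) (b : W₁ →ₗ[E] W₂ →ₛₗ[(c : E →+* E)] E) :
    W₂ →ₗ[E] W₁ →ₛₗ[(c : E →+* E)] E :=
  LinearMap.mk₂'ₛₗ (RingHom.id E) (c : E →+* E) (fun x y => c (b y x))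
    (fun x x' y => by rw [map_add, map_add])
    (fun r x y => by
      rw [LinearMap.map_smulₛₗ, smul_eq_mul, map_mul]
      exact congrArg (· * c (b y x)) (hcc r))
    (fun x y y' => by rw [map_add, LinearMap.add_apply, map_add])
    (fun r x y => by
      rw [map_smul, LinearMap.smul_apply, smul_eq_mul, map_mul]
      rfl)

theorem conjTranspose_apply (hcc : ∀ x, c (c x) = x) (b : W₁ →ₗ[E] W₂ →ₛₗ[(c : E →+* E)] E)
    (x : W₂) (y : W₁) : conjTranspose hcc b x y = c (b y x) := rfl

/-- Pullback of a sesquilinear form. -/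
def sesqComap {W₁' W₂' : Type*} [AddCommGroup W₁'] [Module E W₁'] [AddCommGroup W₂']
    [Module E W₂'] (b : W₁ →ₗ[E] W₂ →ₛₗ[(c : E →+* E)] E) (f : W₁' →ₗ[E] W₁)
    (g : W₂' →ₗ[E] W₂) : W₁' →ₗ[E] W₂' →ₛₗ[(c : E →+* E)] E :=
  LinearMap.mk₂'ₛₗ (RingHom.id E) (c : E →+* E) (fun x y => b (f x) (g y))
    (fun x x' y => by rw [map_add, map_add, LinearMap.add_apply])
    (fun r x y => by rw [map_smul, map_smul, LinearMap.smul_apply]; rfl)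
    (fun x y y' => by rw [map_add, map_add])
    (fun r x y => by rw [map_smul, LinearMap.map_smulₛₗ])

theorem sesqComap_apply {W₁' W₂' : Type*} [AddCommGroup W₁'] [Module E W₁'] [AddCommGroup W₂']
    [Module E W₂'] (b : W₁ →ₗ[E] W₂ →ₛₗ[(c : E →+* E)] E) (f : W₁' →ₗ[E] W₁)
    (g : W₂' →ₗ[E] W₂) (x : W₁') (y : W₂') : sesqComap b f g x y = b (f x) (g y) := rfl

/-- Pullback of a skew form. -/
def skewFormsComap (f : W₁ →ₗ[E] W₂) (β : skewForms c ε W₂) : skewForms c ε W₁ :=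
  ⟨sesqComap β.1 f f, fun x y => β.2 (f x) (f y)⟩

theorem skewFormsComap_apply (f : W₁ →ₗ[E] W₂) (β : skewForms c ε W₂) (x y : W₁) :
    (skewFormsComap f β).1 x y = β.1 (f x) (f y) := rfl

/-- Skew forms on isomorphic spaces. -/
def skewFormsCongr (e : W₁ ≃ₗ[E] W₂) : skewForms c ε W₂ ≃ skewForms c ε W₁ where
  toFun := skewFormsComap e.toLinearMap
  invFun := skewFormsComap e.symm.toLinearMap
  left_inv β := by
    refine Subtype.ext (LinearMap.ext fun x => LinearMap.ext fun y => ?_)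
    simp [skewFormsComap_apply]
  right_inv β := by
    refine Subtype.ext (LinearMap.ext fun x => LinearMap.ext fun y => ?_)
    simp [skewFormsComap_apply]

/-- The skew form on a product with given blocks. -/
def skewFormsProdMk (hcc : ∀ x, c (c x) = x) (β₁ : skewForms c ε W₁) (β₂ : skewForms c ε W₂)
    (b : W₁ →ₗ[E] W₂ →ₛₗ[(c : E →+* E)] E) : skewForms c ε (W₁ × W₂) :=
  ⟨sesqComap β₁.1 (LinearMap.fst E W₁ W₂) (LinearMap.fst E W₁ W₂) +
      sesqComap β₂.1 (LinearMap.snd E W₁ W₂) (LinearMap.snd E W₁ W₂) +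
      sesqComap b (LinearMap.fst E W₁ W₂) (LinearMap.snd E W₁ W₂) -
      ((ε : ℤ) : E) • sesqComap (conjTranspose hcc b) (LinearMap.snd E W₁ W₂)
        (LinearMap.fst E W₁ W₂), by
    intro x y
    have e := EpsForm.sign_mul_self (E := E) ε
    have h1 := β₁.2 x.1 y.1
    have h2 := β₂.2 x.2 y.2
    simp only [LinearMap.add_apply, LinearMap.sub_apply, LinearMap.smul_apply,
      sesqComap_apply, LinearMap.fst_apply, LinearMap.snd_apply,
      conjTranspose_apply, smul_eq_mul, map_add, map_sub, map_mul, hcc, map_intCast, h1, h2]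
    linear_combination -(b y.1 x.2) * e⟩

theorem skewFormsProdMk_apply (hcc : ∀ x, c (c x) = x) (β₁ : skewForms c ε W₁)
    (β₂ : skewForms c ε W₂) (b : W₁ →ₗ[E] W₂ →ₛₗ[(c : E →+* E)] E) (x y : W₁ × W₂) :
    (skewFormsProdMk hcc β₁ β₂ b).1 x y =
      β₁.1 x.1 y.1 + β₂.1 x.2 y.2 + b x.1 y.2 - ((ε : ℤ) : E) * c (b y.1 x.2) := rfl

/-- A skew form on a product is given by its two diagonal blocks and one off-diagonal block. -/
def skewFormsProdEquiv (hcc : ∀ x, c (c x) = x) :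
    skewForms c ε (W₁ × W₂) ≃
      skewForms c ε W₁ × skewForms c ε W₂ × (W₁ →ₗ[E] W₂ →ₛₗ[(c : E →+* E)] E) where
  toFun β := (skewFormsComap (LinearMap.inl E W₁ W₂) β, skewFormsComap (LinearMap.inr E W₁ W₂) β,
    sesqComap β.1 (LinearMap.inl E W₁ W₂) (LinearMap.inr E W₁ W₂))
  invFun t := skewFormsProdMk hcc t.1 t.2.1 t.2.2
  left_inv β := by
    refine Subtype.ext (LinearMap.ext fun x => LinearMap.ext fun y => ?_)
    rw [skewFormsProdMk_apply]
    simp only [skewFormsComap_apply, sesqComap_apply, LinearMap.inl_apply, LinearMap.inr_apply]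
    have h := β.2 (y.1, 0) (0, x.2)
    have hx : β.1 x = β.1 (x.1, 0) + β.1 (0, x.2) := by rw [← map_add]; simp
    have hy : ∀ z, β.1 z y = β.1 z (y.1, 0) + β.1 z (0, y.2) := by
      intro z; rw [← map_add]; simp
    rw [hx, LinearMap.add_apply, hy, hy, h]
    ring
  right_inv t := by
    refine Prod.ext (Subtype.ext (LinearMap.ext fun x => LinearMap.ext fun y => ?_))
      (Prod.ext (Subtype.ext (LinearMap.ext fun x => LinearMap.ext fun y => ?_))
        (LinearMap.ext fun x => LinearMap.ext fun y => ?_))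
    · rw [skewFormsComap_apply, skewFormsProdMk_apply]
      simp
    · rw [skewFormsComap_apply, skewFormsProdMk_apply]
      simp
    · rw [sesqComap_apply, skewFormsProdMk_apply]
      simp

end SkewForms

namespace EpsForm

variable {c : E ≃ₐ[F] E} {ε : ℤˣ} {V : Type*} [AddCommGroup V] [Module E V]

theorem eq_zero_of_form_eq_zero (B : EpsForm c ε V) (hB : B.IsNondegenerate) {x : V}
    (h : ∀ y, B.form x y = 0) : x = 0 := by
  by_contra h0
  obtain ⟨y, hy⟩ := hB x h0
  exact hy (h y)

/-- Nondegeneracy makes composition with the form injective, and both finite sets have the same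
order. -/
theorem exists_form_apply_eq [Finite E] [FiniteDimensional E V] (B : EpsForm c ε V)
    (hB : B.IsNondegenerate) (β : V →ₗ[E] V →ₛₗ[(c : E →+* E)] E) :
    ∃ A : V →ₗ[E] V, B.form ∘ₗ A = β := by
  have hcard : Nat.card (V →ₗ[E] V) = Nat.card (V →ₗ[E] V →ₛₗ[(c : E →+* E)] E) := by
    rw [natCard_linearMap, natCard_sesqForm]
  have : Finite (V →ₗ[E] V) := Module.finite_of_finite E
  have : Finite (V →ₗ[E] V →ₛₗ[(c : E →+* E)] E) := by
    apply Nat.finite_of_card_ne_zero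
    rw [← hcard]
    exact Nat.card_pos.ne'
  have hinj : Function.Injective fun A : V →ₗ[E] V => B.form ∘ₗ A := by
    intro A A' h
    refine LinearMap.ext fun x => sub_eq_zero.mp (B.eq_zero_of_form_eq_zero hB fun y => ?_)
    have h1 : B.form (A x) y = B.form (A' x) y :=
      congrArg (fun L : V →ₗ[E] V →ₛₗ[(c : E →+* E)] E => L x y) h
    rw [map_sub, LinearMap.sub_apply, h1, sub_self]
  exact ((Nat.bijective_iff_injective_and_card _).mpr ⟨hinj, hcard⟩).2 β

/-- The Lie algebra of the isometry group of a nondegenerate form, as a space of skew forms. -/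
def lieAlgebraEquiv [Module F V] [IsScalarTower F E V] [Finite E] [FiniteDimensional E V]
    (B : EpsForm c ε V) (hB : B.IsNondegenerate) : B.lieAlgebra ≃ skewForms c ε V :=
  Equiv.ofBijective (fun A => ⟨B.form ∘ₗ A.1, fun x y => by
      have h : B.form (A.1 x) y + B.form x (A.1 y) = 0 := A.2 x y
      have h1 := B.symm x (A.1 y)
      have h2 := B.symm (A.1 x) y
      have h3 := A.2 y x
      have e := sign_mul_self (E := E) ε
      change B.form (A.1 y) x = -(((ε : ℤ) : E) * c (B.form (A.1 x) y))
      have h4 : B.form (A.1 y) x + B.form y (A.1 x) = 0 := h3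
      linear_combination h4 - h2⟩) (by
    constructor
    · intro A A' h
      refine Subtype.ext (LinearMap.ext fun x =>
        sub_eq_zero.mp (B.eq_zero_of_form_eq_zero hB fun y => ?_))
      have h1 : B.form (A.1 x) y = B.form (A'.1 x) y :=
        congrArg (fun L : skewForms c ε V => L.1 x y) h
      rw [map_sub, LinearMap.sub_apply, h1, sub_self]
    · intro β
      obtain ⟨A, hA⟩ := B.exists_form_apply_eq hB β.1
      have hA' : ∀ x y, B.form (A x) y = β.1 x y := fun x y =>
        congrArg (fun L : V →ₗ[E] V →ₛₗ[(c : E →+* E)] E => L x y) hA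
      refine ⟨⟨A, fun x y => ?_⟩, Subtype.ext hA⟩
      rw [B.symm (A y) x, hA', hA', β.2 y x]
      ring)

end EpsForm

end

/-! ### The nilradical, the unipotent radical and the order of the Lie algebra. -/

section

namespace Decomposition

variable {F : Type*} {E : Type*} [Field F] [Field E] [Algebra F E]
  {c : E ≃ₐ[F] E} {ε : ℤˣ} {V : Type*} [AddCommGroup V] [Module E V]
  {B : EpsForm c ε V} {D : Decomposition B}

section Nilradical

variable [Module F V] [IsScalarTower F E V]

variable (D) in
/-- The Lie algebra of the unipotent radical of the parabolic subgroup. -/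
def nilradical : Set B.lieAlgebra :=
  {A | (∀ x : D.X, A.1 x = 0) ∧ ∀ v v' : D.V₀, B.form (A.1 v) v' = 0}

theorem form_add_eq_zero (A : B.lieAlgebra) (x y : V) :
    B.form (A.1 x) y + B.form x (A.1 y) = 0 := A.2 x y

theorem apply_mem_sup_of_mem_nilradical (hD : D.InDuality) {A : B.lieAlgebra}
    (hA : A ∈ D.nilradical) (u : V) : A.1 u ∈ D.X ⊔ D.V₀ := by
  refine hD.mem_sup fun x hx => ?_
  have h := form_add_eq_zero A x u
  rwa [hA.1 ⟨x, hx⟩, map_zero, LinearMap.zero_apply, zero_add] at h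

/-- Together with the preceding lemma, A lowers the filtration V ⊃ X ⊕ V₀ ⊃ X ⊃ 0 by one step, so A³
= 0. -/
theorem apply_mem_X_of_mem_nilradical (hD : D.InDuality) (h₀ : D.form₀.IsNondegenerate)
    {A : B.lieAlgebra} (hA : A ∈ D.nilradical) {u : V} (hu : u ∈ D.X ⊔ D.V₀) : A.1 u ∈ D.X := by
  obtain ⟨x, hx, v, hv, rfl⟩ := Submodule.mem_sup.mp hu
  rw [map_add, hA.1 ⟨x, hx⟩, zero_add]
  refine hD.mem_X h₀ fun w hw => ?_
  obtain ⟨x', hx', v', hv', rfl⟩ := Submodule.mem_sup.mp hw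
  have h1 := form_add_eq_zero A v x'
  rw [hA.1 ⟨x', hx'⟩, map_zero, add_zero] at h1
  rw [map_add, LinearMap.add_apply, B.form_eq_zero_comm h1, zero_add]
  exact B.form_eq_zero_comm (hA.2 ⟨v, hv⟩ ⟨v', hv'⟩)

variable (D) in
/-- The Lie algebra of `G(V)` in terms of the blocks of the associated skew forms. -/
def lieAlgebraBlockEquiv [Finite E] [FiniteDimensional E V] (hcc : ∀ x, c (c x) = x)
    (hB : B.IsNondegenerate) :
    B.lieAlgebra ≃ skewForms c ε D.X ×
      (skewForms c ε D.V₀ × skewForms c ε D.Y × (D.V₀ →ₗ[E] D.Y →ₛₗ[(c : E →+* E)] E)) ×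
      (D.X →ₗ[E] (D.V₀ × D.Y) →ₛₗ[(c : E →+* E)] E) :=
  (B.lieAlgebraEquiv hB).trans ((skewFormsCongr D.sumEquiv).trans ((skewFormsProdEquiv hcc).trans
    (Equiv.prodCongr (Equiv.refl _) (Equiv.prodCongr (skewFormsProdEquiv hcc) (Equiv.refl _)))))

theorem mem_nilradical_iff [Finite E] [FiniteDimensional E V] (hcc : ∀ x, c (c x) = x)
    (hB : B.IsNondegenerate) (A : B.lieAlgebra) :
    A ∈ D.nilradical ↔ (D.lieAlgebraBlockEquiv hcc hB A).1 = 0 ∧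
      (D.lieAlgebraBlockEquiv hcc hB A).2.1.1 = 0 ∧
      (D.lieAlgebraBlockEquiv hcc hB A).2.2 = 0 := by
  have h1 : ∀ x x' : D.X, (D.lieAlgebraBlockEquiv hcc hB A).1.1 x x' =
      B.form (A.1 (D.sumEquiv (x, 0, 0))) (D.sumEquiv (x', 0, 0)) := fun _ _ => rfl
  have h2 : ∀ v v' : D.V₀, (D.lieAlgebraBlockEquiv hcc hB A).2.1.1.1 v v' =
      B.form (A.1 (D.sumEquiv (0, v, 0))) (D.sumEquiv (0, v', 0)) := fun _ _ => rfl
  have h3 : ∀ (x : D.X) (w : D.V₀ × D.Y), (D.lieAlgebraBlockEquiv hcc hB A).2.2 x w =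
      B.form (A.1 (D.sumEquiv (x, 0, 0))) (D.sumEquiv (0, w)) := fun _ _ => rfl
  have sX : ∀ x : D.X, D.sumEquiv (x, 0, 0) = x := fun x => by simp [sumEquiv_apply]
  have sV : ∀ v : D.V₀, D.sumEquiv (0, v, 0) = v := fun v => by simp [sumEquiv_apply]
  simp only [sX, sV] at h1 h2 h3
  constructor
  · intro hA
    refine ⟨Subtype.ext (LinearMap.ext fun x => LinearMap.ext fun x' => ?_),
      Subtype.ext (LinearMap.ext fun v => LinearMap.ext fun v' => ?_),
      LinearMap.ext fun x => LinearMap.ext fun w => ?_⟩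
    · rw [h1, hA.1]
      simp
    · rw [h2, hA.2]
      simp
    · rw [h3, hA.1]
      simp
  · rintro ⟨e1, e2, e3⟩
    refine ⟨fun x => B.eq_zero_of_form_eq_zero hB fun u => ?_, fun v v' => ?_⟩
    · obtain ⟨⟨x', w⟩, rfl⟩ := D.sumEquiv.surjective u
      have hsplit : D.sumEquiv (x', w) = (x' : V) + D.sumEquiv (0, w) := by
        rw [← sX, ← map_add]
        simp
      rw [hsplit, map_add, ← h1, ← h3, e1, e3]
      simp
    · rw [← h2, e2]
      simp

theorem natCard_nilradical [Finite E] [FiniteDimensional E V] (hcc : ∀ x, c (c x) = x)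
    (hB : B.IsNondegenerate) :
    Nat.card D.nilradical = Nat.card (skewForms c ε D.Y) *
      Nat.card (D.V₀ →ₗ[E] D.Y →ₛₗ[(c : E →+* E)] E) := by
  rw [← Nat.card_prod]
  refine Nat.card_congr ((Equiv.subtypeEquiv (D.lieAlgebraBlockEquiv hcc hB)
    (q := fun t => t.1 = 0 ∧ t.2.1.1 = 0 ∧ t.2.2 = 0) (mem_nilradical_iff (D := D) hcc hB)).trans
    { toFun := fun t => t.1.2.1.2
      invFun := fun t => ⟨(0, (0, t), 0), rfl, rfl, rfl⟩
      left_inv := ?_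
      right_inv := fun t => rfl })
  rintro ⟨⟨t₁, ⟨t₂, t₃⟩, t₄⟩, h₁, h₂, h₃⟩
  change t₁ = 0 at h₁
  change t₂ = 0 at h₂
  change t₄ = 0 at h₃
  subst h₁ h₂ h₃
  rfl

/-- The exponential map identifies the nilradical with the unipotent radical. -/
theorem natCard_unipotentRadical [FiniteDimensional E V] (h2 : (2 : E) ≠ 0)
    (hB : B.IsNondegenerate) (hD : D.InDuality) (h₀ : D.form₀.IsNondegenerate) :
    Nat.card (D.leviX.prod D.leviV₀).ker = Nat.card D.nilradical := by
  have hc2 : c (2⁻¹ : E) = 2⁻¹ := by rw [map_inv₀, map_ofNat]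
  have h22 : (2⁻¹ : E) + 2⁻¹ = 1 := by field_simp; norm_num
  -- Since A³ = 0, the exponential is 1 + A + A²/2. The terms of degree three and four in the
  -- expansion vanish because A² maps into X and A into X^⊥.
  have hexp : ∀ A ∈ D.nilradical, ∀ u u' : V,
      B.form (u + A.1 u + (2⁻¹ : E) • A.1 (A.1 u)) (u' + A.1 u' + (2⁻¹ : E) • A.1 (A.1 u')) =
        B.form u u' := by
    intro A hA u u'
    have hU := apply_mem_sup_of_mem_nilradical hD hA
    have hX := fun u => apply_mem_X_of_mem_nilradical hD h₀ hA (hU u)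
    have e1 := form_add_eq_zero A u u'
    have e2 := form_add_eq_zero A (A.1 u) u'
    have e3 := form_add_eq_zero A u (A.1 u')
    have e4 : B.form (A.1 (A.1 u)) (A.1 u') = 0 := D.form_X_sup (hX u) (hU u')
    have e5 : B.form (A.1 u) (A.1 (A.1 u')) = 0 := D.form_sup_X (hX u') (hU u)
    have e6 : B.form (A.1 (A.1 u)) (A.1 (A.1 u')) = 0 :=
      D.isotropic_X _ (hX u) _ (hX u')
    simp only [map_add, LinearMap.add_apply, EpsForm.form_smul_left, EpsForm.form_smul_right,
      hc2, e4, e5, e6]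
    linear_combination e1 + 2⁻¹ * e2 + 2⁻¹ * e3 - B.form (A.1 u) (A.1 u') * h22
  let expMap : D.nilradical → (D.leviX.prod D.leviV₀).ker := fun A =>
    D.unipotentMk (B.isometryOfEnd hB (1 + A.1.1 + (2⁻¹ : E) • (A.1.1 ∘ₗ A.1.1)) (hexp A.1 A.2))
      (fun x hx => by
        change x + A.1.1 x + (2⁻¹ : E) • A.1.1 (A.1.1 x) = x
        rw [A.2.1 ⟨x, hx⟩]
        simp)
      (fun v hv => by
        change v + A.1.1 v + (2⁻¹ : E) • A.1.1 (A.1.1 v) - v ∈ D.X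
        have h1 := apply_mem_X_of_mem_nilradical hD h₀ A.2 (Submodule.mem_sup_right hv)
        rw [A.2.1 ⟨_, h1⟩, smul_zero, add_zero, add_sub_cancel_left]
        exact h1)
  have hexpMap : ∀ (A : D.nilradical) (u : V),
      (((expMap A : D.parabolic) : B.isometryGroup) : V ≃ₗ[E] V) u =
        u + A.1.1 u + (2⁻¹ : E) • A.1.1 (A.1.1 u) := fun A u => rfl
  refine (Nat.card_eq_of_bijective expMap ⟨fun A A' h => ?_, fun n => ?_⟩).symm
  -- Injectivity: with R = exp(A) − 1, the truncated logarithm R − R²/2 recovers A.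
  · have key : ∀ A : D.nilradical, ∀ u, A.1.1 u =
        ((((expMap A : D.parabolic) : B.isometryGroup) : V ≃ₗ[E] V) u - u) -
        (2⁻¹ : E) • ((((expMap A : D.parabolic) : B.isometryGroup) : V ≃ₗ[E] V)
          ((((expMap A : D.parabolic) : B.isometryGroup) : V ≃ₗ[E] V) u - u) -
          ((((expMap A : D.parabolic) : B.isometryGroup) : V ≃ₗ[E] V) u - u)) := by
      intro A u
      have h3 : A.1.1 (A.1.1 (A.1.1 u)) = 0 := A.2.1 ⟨_, apply_mem_X_of_mem_nilradical hD h₀ A.2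
        (apply_mem_sup_of_mem_nilradical hD A.2 u)⟩
      simp only [hexpMap, map_sub, map_add, map_smul, h3, map_zero]
      module
    refine Subtype.ext (Subtype.ext (LinearMap.ext fun u => ?_))
    rw [key A, key A', h]
  · obtain ⟨hX, hV₀⟩ := (D.mem_ker_levi_iff _).mp n.2
    set g : B.isometryGroup := ((n : D.parabolic) : B.isometryGroup) with hg
    let R : V →ₗ[E] V := ((g : V ≃ₗ[E] V) : V →ₗ[E] V) - LinearMap.id
    have hR : ∀ u, R u = (g : V ≃ₗ[E] V) u - u := fun u => rfl
    have hRX : ∀ x ∈ D.X, R x = 0 := fun x hx => by rw [hR, hX x hx, sub_self]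
    have hRU : ∀ u ∈ D.X ⊔ D.V₀, R u ∈ D.X := by
      intro u hu
      obtain ⟨x, hx, v, hv, rfl⟩ := Submodule.mem_sup.mp hu
      rw [map_add, hRX x hx, zero_add]
      exact hV₀ v hv
    have hiso : ∀ u u', B.form (R u) u' + B.form u (R u') + B.form (R u) (R u') = 0 := by
      intro u u'
      have h : B.form ((g : V ≃ₗ[E] V) u) ((g : V ≃ₗ[E] V) u') = B.form u u' := g.2 u u'
      simp only [hR, map_sub, LinearMap.sub_apply]
      linear_combination h
    have hRV : ∀ u, R u ∈ D.X ⊔ D.V₀ := fun u => hD.mem_sup fun x hx => by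
      have := hiso x u
      rwa [hRX x hx, map_zero, LinearMap.zero_apply, LinearMap.zero_apply, zero_add,
        add_zero] at this
    have hskew : ∀ u u', B.form (R u - (2⁻¹ : E) • R (R u)) u' +
        B.form u (R u' - (2⁻¹ : E) • R (R u')) = 0 := by
      intro u u'
      have e1 := hiso u u'
      have e2 := hiso (R u) u'
      have e3 := hiso u (R u')
      rw [D.form_X_sup (hRU _ (hRV u)) (hRV u')] at e2
      rw [D.form_sup_X (hRU _ (hRV u')) (hRV u)] at e3
      simp only [map_sub, LinearMap.sub_apply, EpsForm.form_smul_left, EpsForm.form_smul_right, hc2]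
      linear_combination e1 - 2⁻¹ * e2 - 2⁻¹ * e3 + B.form (R u) (R u') * h22
    -- Surjectivity: the logarithm of g = 1 + R, where R³ = 0.
    let A : B.lieAlgebra := ⟨R - (2⁻¹ : E) • (R ∘ₗ R), hskew⟩
    have hAapp : ∀ u, A.1 u = R u - (2⁻¹ : E) • R (R u) := fun u => rfl
    have hA : A ∈ D.nilradical := by
      refine ⟨fun x => ?_, fun v v' => ?_⟩
      · rw [hAapp, hRX x x.2]
        simp
      · have h1 := hRU v (Submodule.mem_sup_right v.2)
        rw [hAapp, hRX _ h1, smul_zero, sub_zero]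
        exact D.form_X_sup h1 (Submodule.mem_sup_right v'.2)
    refine ⟨⟨A, hA⟩, Subtype.ext (Subtype.ext (Subtype.ext (LinearEquiv.ext fun u => ?_)))⟩
    rw [hexpMap]
    have h3 : R (R (R u)) = 0 := hRX _ (hRU _ (hRV u))
    simp only [hAapp, map_sub, map_smul, h3, map_zero]
    have hu : (g : V ≃ₗ[E] V) u = u + R u := by rw [hR]; abel
    change _ = (g : V ≃ₗ[E] V) u
    rw [hu]
    module

/-- Of the blocks of a skew form, those on Y × Y and V₀ × Y count N. The blocks on X × X and X × V₀
have the same orders because dim X = dim Y, giving the second factor |N|; the X × Y block counts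
𝔤𝔩(X). -/
theorem natCard_lieAlgebra [Finite E] [FiniteDimensional E V] (h2 : (2 : E) ≠ 0)
    (hcc : ∀ x, c (c x) = x)
    (hB : B.IsNondegenerate) (hD : D.InDuality) (h₀ : D.form₀.IsNondegenerate) :
    Nat.card B.lieAlgebra = Nat.card (0 : EpsForm c ε D.X).lieAlgebra *
      Nat.card D.form₀.lieAlgebra * Nat.card (D.leviX.prod D.leviV₀).ker ^ 2 := by
  have hX : Nat.card (0 : EpsForm c ε D.X).lieAlgebra =
      Nat.card E ^ (Module.finrank E D.X * Module.finrank E D.X) := by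
    rw [← natCard_linearMap]
    exact Nat.card_congr (Equiv.subtypeUnivEquiv fun A x y => by
      change (0 : E) + 0 = 0
      rw [add_zero])
  have hV₀ := Nat.card_congr (D.form₀.lieAlgebraEquiv h₀)
  have hXY : Nat.card (skewForms c ε D.X) = Nat.card (skewForms c ε D.Y) :=
    Nat.card_congr (skewFormsCongr (LinearEquiv.ofFinrankEq D.Y D.X hD.finrank_eq.symm))
  have hV := Nat.card_congr (D.lieAlgebraBlockEquiv hcc hB)
  rw [hV, natCard_unipotentRadical h2 hB hD h₀, natCard_nilradical hcc hB, hX, hV₀]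
  simp only [Nat.card_prod, natCard_sesqForm, hXY, Module.finrank_prod, hD.finrank_eq]
  ring

theorem natCard_lieAlgebra_of_form_eq_zero [Finite E] [FiniteDimensional E V] (hB : B.form = 0)
    (hY : D.Y = ⊥) :
    Nat.card B.lieAlgebra = Nat.card (0 : EpsForm c ε D.X).lieAlgebra *
      Nat.card D.form₀.lieAlgebra * Nat.card (D.V₀ →ₗ[E] D.X) ^ 2 := by
  have key : ∀ {W : Type _} [AddCommGroup W] [Module E W] [Module F W] [IsScalarTower F E W]
      [FiniteDimensional E W] (B' : EpsForm c ε W), B'.form = 0 → Nat.card B'.lieAlgebra =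
      Nat.card E ^ (Module.finrank E W * Module.finrank E W) := by
    intro W _ _ _ _ _ B' hB'
    rw [← natCard_linearMap]
    exact Nat.card_congr (Equiv.subtypeUnivEquiv fun A x y => by simp [hB'])
  have hB₀ : D.form₀.form = 0 := by
    ext v w
    change B.form (v : V) (w : V) = 0
    rw [hB]
    rfl
  have hY0 : Module.finrank E D.Y = 0 := by rw [hY]; exact finrank_bot E V
  have hdim := D.sumEquiv.finrank_eq
  rw [Module.finrank_prod, Module.finrank_prod, hY0, add_zero] at hdim
  rw [key B hB, key D.form₀ hB₀, key (0 : EpsForm c ε D.X) rfl, natCard_linearMap, ← hdim]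
  ring

end Nilradical

/-- Each element of N is 1 + φ for a unique map φ from V₀ to X, extended by zero along X. -/
theorem natCard_unipotentRadical_of_form_eq_zero [FiniteDimensional E V] (hB : B.form = 0)
    (hY : D.Y = ⊥) :
    Nat.card (D.leviX.prod D.leviV₀).ker = Nat.card (D.V₀ →ₗ[E] D.X) := by
  let N : (D.V₀ →ₗ[E] D.X) → V →ₗ[E] V := fun φ => D.X.subtype ∘ₗ φ ∘ₗ D.proj₀
  have hN : ∀ φ u, N φ u = (φ (D.proj₀ u) : V) := fun φ u => rfl
  have hNN : ∀ φ φ' u, N φ (N φ' u) = 0 := fun φ φ' u => by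
    rw [hN, hN, D.proj₀_X (φ' _).2, map_zero, Submodule.coe_zero]
  let e : (D.V₀ →ₗ[E] D.X) → V ≃ₗ[E] V := fun φ =>
    LinearEquiv.ofLinearMap (LinearMap.id + N φ) (LinearMap.id - N φ)
      (LinearMap.ext fun u => by simp [hNN])
      (LinearMap.ext fun u => by simp [hNN])
  have he : ∀ φ u, e φ u = u + (φ (D.proj₀ u) : V) := fun φ u => rfl
  let f : (D.V₀ →ₗ[E] D.X) → (D.leviX.prod D.leviV₀).ker := fun φ =>
    D.unipotentMk ⟨e φ, fun x y => by simp [hB]⟩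
      (fun x hx => by
        change e φ x = x
        rw [he, D.proj₀_X hx, map_zero, Submodule.coe_zero, add_zero])
      (fun v _ => by
        change e φ v - v ∈ D.X
        rw [he, add_sub_cancel_left]
        exact (φ _).2)
  have hf : ∀ φ u, (((f φ : D.parabolic) : B.isometryGroup) : V ≃ₗ[E] V) u =
      u + (φ (D.proj₀ u) : V) := fun φ u => rfl
  refine (Nat.card_eq_of_bijective f ⟨fun φ φ' h => ?_, fun n => ?_⟩).symm
  · refine LinearMap.ext fun v => Subtype.ext ?_
    have h1 := hf φ v
    rw [h, hf, D.proj₀_V₀] at h1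
    exact (add_left_cancel h1).symm
  · obtain ⟨hX, hV₀⟩ := (D.mem_ker_levi_iff _).mp n.2
    let g : V ≃ₗ[E] V := (((n : D.parabolic) : B.isometryGroup) : V ≃ₗ[E] V)
    let φ : D.V₀ →ₗ[E] D.X := LinearMap.codRestrict D.X
      (((g : V →ₗ[E] V) - LinearMap.id) ∘ₗ D.V₀.subtype) (fun v => hV₀ v v.2)
    have hφ : ∀ v : D.V₀, (φ v : V) = g v - v := fun v => rfl
    refine ⟨φ, Subtype.ext (Subtype.ext (Subtype.ext (LinearEquiv.ext fun u => ?_)))⟩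
    rw [hf]
    change _ = g u
    obtain ⟨x, hx, h⟩ := D.exists_eq_add (v := u) (D.sup_eq_top hY ▸ Submodule.mem_top)
    have hgu : g u = x + g (D.proj₀ u : V) := by
      conv_lhs => rw [h]
      rw [map_add]
      exact congrArg (· + _) (hX x hx)
    rw [hφ, hgu]
    nth_rewrite 1 [h]
    abel

end Decomposition

end

/-! ### Normalizing factors and the conclusion. -/

section

/-- Writing n = q^m turns the product of orders into a sum of dimensions, and s^{2m} = n. This
extracts the square root consistently with the chosen sign of `s`. -/
theorem sqrt_pow_finrank_eq {F C : Type*} [Field F] [Finite F] [Field C] {s : C}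
    (hs : s ^ 2 = (Nat.card F : C)) {M M₁ M₂ : Type*} [AddCommGroup M] [Module F M] [Finite M]
    [AddCommGroup M₁] [Module F M₁] [Finite M₁] [AddCommGroup M₂] [Module F M₂] [Finite M₂]
    {n m : ℕ} (h : Nat.card M = Nat.card M₁ * Nat.card M₂ * n ^ 2) (hn : n = Nat.card F ^ m) :
    s ^ Module.finrank F M = s ^ Module.finrank F M₁ * s ^ Module.finrank F M₂ * (n : C) := by
  have : Module.Finite F M := Module.Finite.of_finite
  have : Module.Finite F M₁ := Module.Finite.of_finite
  have : Module.Finite F M₂ := Module.Finite.of_finite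
  rw [hn, Module.natCard_eq_pow_finrank (K := F) (V := M),
    Module.natCard_eq_pow_finrank (K := F) (V := M₁),
    Module.natCard_eq_pow_finrank (K := F) (V := M₂), ← pow_add, ← pow_mul, ← pow_add] at h
  rw [Nat.pow_right_injective Finite.one_lt_card h, hn, Nat.cast_pow, ← hs]
  ring

namespace Decomposition

variable {F : Type*} {E : Type*} [Field F] [Field E] [Algebra F E]
  {c : E ≃ₐ[F] E} {ε : ℤˣ} {V : Type*} [AddCommGroup V] [Module E V]
  {B : EpsForm c ε V} {D : Decomposition B}
  [Module F V] [IsScalarTower F E V] [Finite F] [Finite E] [FiniteDimensional E V]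
  {C : Type*} [Field C] {s : C}

instance : Finite B.lieAlgebra :=
  have : Finite V := Module.finite_of_finite E
  have : Finite (V →ₗ[E] V) := Module.finite_of_finite E
  inferInstance

theorem sqrt_pow_finrank_lieAlgebra (hs : s ^ 2 = (Nat.card F : C)) (h2 : (2 : E) ≠ 0)
    (hcc : ∀ x, c (c x) = x)
    (hB : B.IsNondegenerate) (hD : D.InDuality) (h₀ : D.form₀.IsNondegenerate) :
    s ^ Module.finrank F B.lieAlgebra = s ^ Module.finrank F (0 : EpsForm c ε D.X).lieAlgebra *
      s ^ Module.finrank F D.form₀.lieAlgebra * (Nat.card (D.leviX.prod D.leviV₀).ker : C) := by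
  have hN := natCard_unipotentRadical h2 hB hD h₀
  have : Module.Finite F E := Module.Finite.of_finite
  have : Finite (D.Y →ₗ[E] D.Y →ₛₗ[(c : E →+* E)] E) := by
    refine Nat.finite_of_card_ne_zero ?_
    rw [natCard_sesqForm]
    exact pow_ne_zero _ Nat.card_pos.ne'
  let : AddCommGroup (skewForms c ε D.Y) := Module.addCommMonoidToAddCommGroup F
  have : Module.Finite F (skewForms c ε D.Y) := Module.Finite.of_finite
  rw [natCard_nilradical hcc hB, natCard_sesqForm,
    Module.natCard_eq_pow_finrank (K := F) (V := skewForms c ε D.Y),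
    Module.natCard_eq_pow_finrank (K := F) (V := E), ← pow_mul, ← pow_add] at hN
  exact sqrt_pow_finrank_eq hs (natCard_lieAlgebra h2 hcc hB hD h₀) hN

theorem sqrt_pow_finrank_lieAlgebra_of_form_eq_zero (hs : s ^ 2 = (Nat.card F : C))
    (hB : B.form = 0) (hY : D.Y = ⊥) :
    s ^ Module.finrank F B.lieAlgebra = s ^ Module.finrank F (0 : EpsForm c ε D.X).lieAlgebra *
      s ^ Module.finrank F D.form₀.lieAlgebra * (Nat.card (D.leviX.prod D.leviV₀).ker : C) := by
  have hN := natCard_unipotentRadical_of_form_eq_zero hB hY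
  have h := natCard_lieAlgebra_of_form_eq_zero hB hY
  rw [← hN] at h
  have : Module.Finite F E := Module.Finite.of_finite
  rw [natCard_linearMap, Module.natCard_eq_pow_finrank (K := F) (V := E), ← pow_mul] at hN
  exact sqrt_pow_finrank_eq hs h hN

end Decomposition

theorem two_ne_zero_of_odd_natCard {F : Type*} [Field F] [Finite F] (hF : Odd (Nat.card F)) :
    (2 : F) ≠ 0 := by
  have := Fintype.ofFinite F
  rw [Nat.card_eq_fintype_card] at hF
  refine Ring.two_ne_zero fun h => ?_
  exact (Nat.not_even_iff_odd.mpr hF)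
    (Nat.even_iff.mpr (FiniteField.even_card_of_char_two h))

end

end DoublingJacobi

end

open DoublingJacobi in
theorem mainTheorem3
    {F E C V Wτ W₀ : Type*} [Field F] [Finite F] [Field E] [Algebra F E]
    (hF : Odd (Nat.card F))
    (hE : Module.finrank F E = 1 ∨ Module.finrank F E = 2)
    (c : E ≃ₐ[F] E) (hc : ∀ σ : E ≃ₐ[F] E, σ ∈ Subgroup.zpowers c)
    [Field C] [IsAlgClosed C] (hC : (Nat.card F : C) ≠ 0)
    (sqrtq : C) (hsqrtq : sqrtq ^ 2 = (Nat.card F : C))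
    (ε : ℤˣ)
    [AddCommGroup V] [Module E V] [FiniteDimensional E V] [Module F V] [IsScalarTower F E V]
    (B : EpsForm c ε V) (D : Decomposition B)
    (χ : Eˣ →* Cˣ) (hχ : onePlusConjChar c χ ≠ 1)
    [AddCommGroup Wτ] [Module C Wτ]
    (τ : Representation C (D.X ≃ₗ[E] D.X) Wτ) [τ.IsIrreducible]
    [AddCommGroup W₀] [Module C W₀]
    (π₀ : Representation C D.form₀.isometryGroup W₀) [π₀.IsIrreducible] :
    (B.IsNondegenerate → D.form₀.IsNondegenerate → D.InDuality →
      ∃ jτ j₀ : C,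
        jacobiSumGL c ε sqrtq (onePlusConjChar c χ) (twist τ (conjChar c χ)⁻¹) =
          jτ • LinearMap.id ∧
        jacobiSum sqrtq χ D.form₀ π₀ = j₀ • LinearMap.id ∧
        jacobiSum sqrtq χ B (D.parabolicInduction τ π₀) = (jτ * j₀) • LinearMap.id ∧
        ∀ π : Subrepresentation (D.parabolicInduction τ π₀), Representation.IsIrreducible (V := π.toSubmodule) π.toRepresentation →
          ∃ j : C, jacobiSum sqrtq χ B π.toRepresentation = j • LinearMap.id ∧ j = jτ * j₀) ∧
    (B = 0 → D.Y = ⊥ →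
      ∃ jτ j₀ : C,
        jacobiSumGL c ε sqrtq χ τ = jτ • LinearMap.id ∧
        jacobiSum sqrtq χ D.form₀ π₀ = j₀ • LinearMap.id ∧
        jacobiSum sqrtq χ B (D.parabolicInduction τ π₀) = (jτ * j₀) • LinearMap.id ∧
        ∀ π : Subrepresentation (D.parabolicInduction τ π₀), Representation.IsIrreducible (V := π.toSubmodule) π.toRepresentation →
          ∃ j : C, jacobiSum sqrtq χ B π.toRepresentation = j • LinearMap.id ∧ j = jτ * j₀) := by
  have : Module.Finite F E := Module.finite_of_finrank_pos (by omega)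
  have : Finite E := Module.finite_of_finite F
  have hs : sqrtq ≠ 0 := by
    rintro rfl
    rw [zero_pow two_ne_zero] at hsqrtq
    exact hC hsqrtq.symm
  have h2 : (2 : E) ≠ 0 := by
    rw [← map_ofNat (algebraMap F E) 2]
    exact (map_ne_zero _).mpr (two_ne_zero_of_odd_natCard hF)
  have hcc : ∀ x, c (c x) = x := algEquiv_apply_apply hE c
  refine ⟨fun hB h₀ hD => ?_, fun hB hY => ?_⟩
  · exact jacobiSum_parabolicInduction D τ π₀ sqrtq hs χ _ _ (hD.levi_surjective hB)
      (Decomposition.jacobiKernel_parabolic hcc hB hD h₀ χ)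
      (D.finsum_jacobiKernel_eq_zero hC h2 hcc hB hD h₀ χ hχ)
      (Decomposition.sqrt_pow_finrank_lieAlgebra hsqrtq h2 hcc hB hD h₀)
  · have hB' : B.form = 0 := by rw [hB]; rfl
    have hχ1 : χ ≠ 1 := by
      rintro rfl
      exact hχ (MonoidHom.ext fun x => mul_one _)
    have h := jacobiSum_parabolicInduction D τ π₀ sqrtq hs χ χ 1
      (Decomposition.levi_surjective_of_form_eq_zero hB')
      (Decomposition.jacobiKernel_parabolic_of_form_eq_zero hB' hY χ)
      (D.finsum_jacobiKernel_eq_zero_of_form_eq_zero hC χ hχ1 hB' hY)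
      (Decomposition.sqrt_pow_finrank_lieAlgebra_of_form_eq_zero hsqrtq hB' hY)
    rwa [twist_one] at h
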